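/- Let $\mu$ be a probability measure on $\mathbb C$ and let $(z_i)_{i\ge 1}$ be a deterministic sequence of complex numbers that is $\mu$-distributed, i.e. $\frac1n\sum_{i=1}^n\delta_{z_i}\to\mu$ weakly, and log-Cesàro bounded, i.e. the sequence $\frac1n\sum_{i=1}^n\log_+|z_i|$, $n\ge1$, is bounded. Let $(X_i)_{i\ge1}$ be i.i.d. complex-valued random variables that are symmetric ($X_1$ and $-X_1$ have the same law), not almost surely equal to $0$, and satisfy $\mathbf E|X_1|<\infty$; real-valued $X_i$ are included. Let $(\sigma_i)_{i\ge1}$ be a non-increasing sequence of positive real numbers with $\lim_{i\to\infty}\sigma_i=0$. For $n\ge1$ let $$P_n(z)=\prod_{i=1}^n (z-z_i+\sigma_iX_i),$$ and for a polynomial $p$ with at least one zero let $\mathcal M(p)$ be the uniform probability measure on the multiset of complex zeros of $p$ (zeros are counted with multiplicity). Then, in the topology of weak convergence of measures, $\mathcal M(P_n)\to\mu$ almost surely, and for every integer $k\ge0$, $\mathcal M(P_n^{(k)})\to\mu$ in probability as $n\to\infty$, i.e. $\mathbf P\big(\mathcal M(P_n^{(k)})\notin U\big)\to0$ for every weak neighbourhood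 $U$ of $\mu$. -/

import Mathlib

open MeasureTheory ProbabilityTheory Filter Topology Polynomial
open scoped NNReal

noncomputable section

/-- The empirical measure `(1/n) ∑_{i < n} δ_{a i}` of the first `n` terms of a sequence
(the zero measure for `n = 0`). `FiniteMeasure ℂ` carries the topology of weak convergence. -/
def seqEmpiricalMeasure (a : ℕ → ℂ) (n : ℕ) : FiniteMeasure ℂ :=
  (n : ℝ≥0)⁻¹ • ∑ i ∈ Finset.range n, (diracProba (a i)).toFiniteMeasure

/-- The sequence `a` is `μ`-distributed: its empirical measures converge weakly to `μ`. -/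
def IsDistributed (μ : ProbabilityMeasure ℂ) (a : ℕ → ℂ) : Prop :=
  Tendsto (seqEmpiricalMeasure a) atTop (𝓝 μ.toFiniteMeasure)

/-- The sequence `a` is log-Cesàro bounded: the Cesàro means of `log⁺ |a i|` are bounded. -/
def IsLogCesaroBounded (a : ℕ → ℂ) : Prop :=
  ∃ C : ℝ, ∀ n : ℕ, 1 ≤ n → (n : ℝ)⁻¹ * ∑ i ∈ Finset.range n, Real.posLog ‖a i‖ ≤ C

/-- The uniform probability measure on the multiset of complex zeros of `p`, counted with
multiplicity (the zero measure if this multiset is empty). -/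
def zeroMeasure (p : ℂ[X]) : FiniteMeasure ℂ :=
  (Multiset.card p.roots : ℝ≥0)⁻¹ •
    (p.roots.map fun w => (diracProba w).toFiniteMeasure).sum

/-- Convergence in probability of random elements `Y n` of a topological space to a constant `c`:
for every neighbourhood `U` of `c`, the probability that `Y n` lies outside `U` tends to `0`. -/
def TendstoInProbability {Ω E : Type*} [MeasurableSpace Ω] [TopologicalSpace E]
    (P : Measure Ω) (Y : ℕ → Ω → E) (c : E) : Prop :=
  ∀ U ∈ 𝓝 c, Tendsto (fun n => P {ω | Y n ω ∉ U}) atTop (𝓝 0)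

/-- The polynomial `∏_{i < n} (z - z_i + σ_i x_i)` in the variable `z`. -/
def perturbedPoly (z : ℕ → ℂ) (σ : ℕ → ℝ) (x : ℕ → ℂ) (n : ℕ) : ℂ[X] :=
  ∏ i ∈ Finset.range n, (X - C (z i) + C ((σ i : ℂ) * x i))

end

/-! The zeros of `P_n` are `w_i = z_i - σ_i X_i`. Since `σ_i → 0` and the first moment is finite,
the strong law makes the Cesàro means of `σ_i |X_i|` vanish almost surely. Such a perturbation does
not change the limit distribution (`IsDistributed.of_tendsto_cesaro`), which gives the almost sure
statement.

For derivatives, Taylor expansion gives `P_n^{(k)}(z) / P_n(z) = k! e_k(1/(z - w_i))`, with `e_k`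
the elementary symmetric function (`eval_iterate_derivative_rootPoly`). If `1/n` times the logarithm
of the modulus of this quotient tends to `0` in local `L¹`, in probability, then the two zero
measures have the same limit. The usual passage through the Laplacian of the logarithmic potential
is replaced by differences of circle means, which are explicit bump functions of the zeros
(`enorm_sum_smoothing_sub_le`).

The logarithm is bounded above through `|e_k| ≤ (∑ 1/|z - w_i|)^k`. The bound below is
probabilistic: at a fixed `z`, `e_k` is rarely exponentially small. For `k = 1`, random sign flips
and the Littlewood–Offord bound show that long sums `∑ G_i(X_i)` with injective `G_i` have no large
atom. Larger `k` follow by induction: decoupling one block of indices by Cauchy–Schwarz lowers the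
degree by one (`IsSymmetricNoise.exists_anticoncentration`). By Fubini the set of bad `z` in a disc
then has small area with high probability. On it, crude bounds of order `n` suffice, because
logarithmic singularities are uniformly integrable (`lintegral_logPotential_sub_le`). -/

/-! ### Littlewood–Offord counting. -/

/-- Positivity for the lexicographic order on `ℂ = ℝ × ℝ`. -/
def LexPos (d : ℂ) : Prop := 0 < d.re ∨ (d.re = 0 ∧ 0 < d.im)

lemma LexPos.add {c d : ℂ} (hc : LexPos c) (hd : LexPos d) : LexPos (c + d) := by
  simp only [LexPos, Complex.add_re, Complex.add_im] at *
  rcases hc with hc | hc <;> rcases hd with hd | hd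
  · left; linarith
  · left; linarith
  · left; linarith
  · right; constructor <;> linarith

lemma LexPos.ne_zero {d : ℂ} (hd : LexPos d) : d ≠ 0 := by
  rintro rfl
  simp [LexPos] at hd

lemma lexPos_or_lexPos_neg {d : ℂ} (hd : d ≠ 0) : LexPos d ∨ LexPos (-d) := by
  simp only [LexPos, Complex.neg_re, Complex.neg_im]
  rcases lt_trichotomy d.re 0 with h | h | h
  · right; left; linarith
  · rcases lt_trichotomy d.im 0 with h' | h' | h'
    · right; right; constructor <;> linarith
    · exact absurd (Complex.ext h h') hd
    · left; right; exact ⟨h, h'⟩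
  · left; left; exact h

/-- The Littlewood–Offord bound, by Sperner's theorem. -/
lemma card_choice_sum_eq_le {ι : Type*} [Fintype ι] [DecidableEq ι] (a b : ι → ℂ)
    (hab : ∀ i, a i ≠ b i) (x : ℂ) :
    (Finset.univ.filter fun A : Finset ι => ∑ i, (if i ∈ A then a i else b i) = x).card ≤
      (Fintype.card ι).choose (Fintype.card ι / 2) := by
  classical
  -- Exchanging the two choices at the indices of `T` makes every increment lexicographically
  -- positive. Enlarging the chosen set then strictly increases the sum, so sets with equal sums
  -- form an antichain.
  set T : Finset ι := Finset.univ.filter fun i => ¬ LexPos (a i - b i) with hT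
  set 𝒜 : Finset (Finset ι) := Finset.univ.filter
    fun B : Finset ι => ∑ i, (if i ∈ symmDiff B T then a i else b i) = x with h𝒜
  have hle : (Finset.univ.filter
      fun A : Finset ι => ∑ i, (if i ∈ A then a i else b i) = x).card ≤ 𝒜.card := by
    refine Finset.card_le_card_of_injOn (fun A => symmDiff A T) ?_ ?_
    · intro A hA
      simpa [h𝒜] using hA
    · intro A _ B _ h
      exact symmDiff_left_injective T h
  refine hle.trans (IsAntichain.sperner ?_)
  intro B hB B' hB' hne hsub
  simp only [h𝒜, Finset.coe_filter, Finset.mem_univ, true_and, Set.mem_ofPred_eq] at hB hB'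
  have hsum : ∑ i ∈ B' \ B, (if i ∈ T then b i - a i else a i - b i) = 0 := by
    rw [← sub_eq_zero.2 (hB'.trans hB.symm), ← Finset.sum_sub_distrib]
    rw [← Finset.sum_subset (Finset.subset_univ (B' \ B))]
    · refine Finset.sum_congr rfl fun i hi => ?_
      rw [Finset.mem_sdiff] at hi
      by_cases hiT : i ∈ T <;> simp [Finset.mem_symmDiff, hi.1, hi.2, hiT]
    · intro i _ hi
      have : i ∈ B ↔ i ∈ B' := ⟨fun h => hsub h, fun h => by
        by_contra h'
        exact hi (Finset.mem_sdiff.2 ⟨h, h'⟩)⟩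
      simp [Finset.mem_symmDiff, this]
  have hnon : (B' \ B).Nonempty := by
    rw [Finset.sdiff_nonempty]
    exact fun h => hne (Finset.Subset.antisymm hsub h)
  refine LexPos.ne_zero (Finset.sum_induction_nonempty _ LexPos (fun _ _ => LexPos.add) hnon
    fun i _ => ?_) hsum
  split_ifs with hi
  · have := (Finset.mem_filter.1 hi).2
    simpa using (lexPos_or_lexPos_neg (sub_ne_zero.2 (hab i))).resolve_left this
  · by_contra h
    exact hi (Finset.mem_filter.2 ⟨Finset.mem_univ _, h⟩)

/-- Indices outside `T` do not influence the sum: for each of the possible traces `A \ T`, the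
Littlewood–Offord bound applies to the choices made on `T`. -/
lemma card_choice_sum_eq_le_of_ne_on {ι : Type*} [Fintype ι] [DecidableEq ι] (a b : ι → ℂ)
    (T : Finset ι) (hab : ∀ i ∈ T, a i ≠ b i) (hab' : ∀ i ∉ T, a i = b i) (x : ℂ) :
    (Finset.univ.filter fun A : Finset ι => ∑ i, (if i ∈ A then a i else b i) = x).card ≤
      T.card.choose (T.card / 2) * 2 ^ (Fintype.card ι - T.card) := by
  classical
  set 𝒜 := Finset.univ.filter fun A : Finset ι => ∑ i, (if i ∈ A then a i else b i) = x with h𝒜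
  have himg : (𝒜.image fun A => A \ T).card ≤ 2 ^ (Fintype.card ι - T.card) := by
    rw [← Finset.card_compl, ← Finset.card_powerset]
    refine Finset.card_le_card fun B hB => ?_
    obtain ⟨A, _, rfl⟩ := Finset.mem_image.1 hB
    rw [Finset.mem_powerset]
    intro i hi
    simpa using (Finset.mem_sdiff.1 hi).2
  refine (Finset.card_le_mul_card_image 𝒜 (T.card.choose (T.card / 2)) fun B _ => ?_).trans
    (Nat.mul_le_mul_left _ himg)
  have h := card_choice_sum_eq_le (fun i : {i // i ∈ T} => a i) (fun i => b i)
    (fun i => hab i i.2) (x - ∑ i ∈ Tᶜ, b i)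
  rw [Fintype.card_coe] at h
  refine le_trans (Finset.card_le_card_of_injOn (fun A => A.subtype (· ∈ T)) ?_ ?_) h
  · intro A hA
    simp only [h𝒜, Finset.coe_filter, Finset.mem_filter, Finset.mem_univ, true_and,
      Set.mem_ofPred_eq] at hA
    simp only [Finset.coe_filter, Finset.mem_univ, true_and, Set.mem_ofPred_eq,
      Finset.mem_subtype]
    rw [Finset.sum_coe_sort T (fun i => if i ∈ A then a i else b i), ← hA.1,
      ← Finset.sum_add_sum_compl T, eq_sub_iff_add_eq, add_right_inj]
    refine Finset.sum_congr rfl fun i hi => ?_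
    rw [hab' i (by simpa using hi)]
    simp
  · intro A hA A' hA' hAA'
    simp only [Finset.coe_filter, Set.mem_ofPred_eq] at hA hA'
    have h1 : A \ T = A' \ T := hA.2.trans hA'.2.symm
    ext i
    by_cases hi : i ∈ T
    · have := congrArg (fun s => (⟨i, hi⟩ : {i // i ∈ T}) ∈ s) hAA'
      simpa using this
    · have := congrArg (fun s => i ∈ s) h1
      simpa [hi] using this

/-! ### Size of the middle binomial coefficient. -/

/-- The ratio of the two sides is monotone in `n`, because `(2n + 1)(2n + 3) ≤ 4 (n + 1)²`. -/
lemma succ_mul_centralBinom_sq_le (n : ℕ) : (2 * n + 1) * n.centralBinom ^ 2 ≤ 16 ^ n := by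
  induction n with
  | zero => simp
  | succ n ih =>
    have h := Nat.succ_mul_centralBinom_succ n
    have h2 : (n + 1) ^ 2 * ((2 * (n + 1) + 1) * (n + 1).centralBinom ^ 2) ≤
        (n + 1) ^ 2 * 16 ^ (n + 1) := by
      calc (n + 1) ^ 2 * ((2 * (n + 1) + 1) * (n + 1).centralBinom ^ 2)
          = (2 * n + 3) * ((n + 1) * (n + 1).centralBinom) ^ 2 := by ring
        _ = (2 * n + 3) * (2 * n + 1) * 4 * ((2 * n + 1) * n.centralBinom ^ 2) := by rw [h]; ring
        _ ≤ (2 * n + 3) * (2 * n + 1) * 4 * 16 ^ n := Nat.mul_le_mul_left _ ih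
        _ ≤ 16 * (n + 1) ^ 2 * 16 ^ n := Nat.mul_le_mul_right _ (by nlinarith)
        _ = _ := by ring
    exact Nat.le_of_mul_le_mul_left h2 (by positivity)

lemma succ_mul_choose_half_sq_le (N : ℕ) : (N + 1) * (N.choose (N / 2)) ^ 2 ≤ 4 ^ N := by
  obtain ⟨n, rfl | rfl⟩ := Nat.even_or_odd' N
  · have h := succ_mul_centralBinom_sq_le n
    rw [Nat.centralBinom] at h
    rw [Nat.mul_div_cancel_left n (by norm_num), pow_mul]
    exact h
  · have h := succ_mul_centralBinom_sq_le (n + 1)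
    have h1 : (n + 1).centralBinom = 2 * (2 * n + 1).choose n := by
      rw [Nat.centralBinom, show 2 * (n + 1) = (2 * n + 1) + 1 by ring, Nat.choose_succ_succ,
        Nat.choose_symm_half]
      ring
    rw [h1] at h
    have h2 : (2 * n + 1) / 2 = n := by omega
    rw [h2, pow_succ 4, pow_mul]
    norm_num
    rw [pow_succ 16] at h
    nlinarith

/-- The proportion of the middle layer of the Boolean lattice. -/
noncomputable def middleRatio (N : ℕ) : ℝ := (N.choose (N / 2) : ℝ) / 2 ^ N

lemma middleRatio_nonneg (N : ℕ) : 0 ≤ middleRatio N := by unfold middleRatio; positivity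

lemma middleRatio_le (N : ℕ) : middleRatio N ≤ (Real.sqrt (N + 1))⁻¹ := by
  have h : ((N : ℝ) + 1) * (N.choose (N / 2) : ℝ) ^ 2 ≤ 4 ^ N := by
    exact_mod_cast succ_mul_choose_half_sq_le N
  rw [← Real.sqrt_inv]
  apply Real.le_sqrt_of_sq_le
  rw [middleRatio, div_pow, ← pow_mul, mul_comm N 2, pow_mul, inv_eq_one_div,
    div_le_div_iff₀ (by positivity) (by positivity)]
  norm_num
  linarith

lemma middleRatio_le_one (N : ℕ) : middleRatio N ≤ 1 := by
  refine (middleRatio_le N).trans (inv_le_one_of_one_le₀ ?_)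
  rw [Real.one_le_sqrt]
  linarith [N.cast_nonneg (α := ℝ)]

lemma tendsto_middleRatio : Tendsto middleRatio atTop (𝓝 0) := by
  refine squeeze_zero middleRatio_nonneg middleRatio_le ?_
  refine tendsto_inv_atTop_zero.comp (Real.tendsto_sqrt_atTop.comp ?_)
  exact tendsto_atTop_add_const_right _ _ tendsto_natCast_atTop_atTop

/-! ### Atoms of sums of functions of symmetric noise. -/

/-- An i.i.d. sequence of symmetric complex random variables that are not almost surely zero. -/
structure IsSymmetricNoise {Ω : Type*} [MeasurableSpace Ω] (P : Measure Ω) (X : ℕ → Ω → ℂ) :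
    Prop where
  measurable : ∀ i, Measurable (X i)
  indep : iIndepFun X P
  ident : ∀ i, IdentDistrib (X i) (X 0) P P
  symm : IdentDistrib (X 0) (fun ω => -X 0 ω) P P
  ne_zero : ¬ ∀ᵐ ω ∂P, X 0 ω = 0

section Anticoncentration

variable {Ω : Type*} [MeasurableSpace Ω] {P : Measure Ω} {X : ℕ → Ω → ℂ}

lemma IsSymmetricNoise.shift (h : IsSymmetricNoise P X) (a : ℕ) :
    IsSymmetricNoise P (fun i => X (a + i)) where
  measurable _ := h.measurable _
  indep := h.indep.precomp (add_right_injective a)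
  ident _ := (h.ident _).trans (h.ident _).symm
  symm := ((h.ident a).trans h.symm).trans ((h.ident a).symm.comp measurable_neg)
  ne_zero h0 := h.ne_zero ((h.ident a).ae_snd (measurableSet_singleton (0 : ℂ)) h0)

lemma IsSymmetricNoise.isProbabilityMeasure (h : IsSymmetricNoise P X) : IsProbabilityMeasure P :=
  h.indep.isProbabilityMeasure

/-- Independence and symmetry of each coordinate make the joint law invariant under any fixed
pattern of sign changes. This supplies the binary choices for the Littlewood–Offord bound. -/
lemma IsSymmetricNoise.identDistrib_flip (h : IsSymmetricNoise P X) {m : ℕ}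
    (A : Finset (Fin m)) :
    IdentDistrib (fun ω (i : Fin m) => X i ω)
      (fun ω (i : Fin m) => if i ∈ A then X i ω else - X i ω) P P := by
  have h1 : iIndepFun (fun (i : Fin m) ω => X i ω) P := h.indep.precomp Fin.val_injective
  have h2 : iIndepFun (fun (i : Fin m) ω => if i ∈ A then X i ω else - X i ω) P := by
    refine iIndepFun_congr ?_ |>.1 (h1.comp (fun i x => if i ∈ A then x else -x) fun i => ?_)
    · intro i
      exact Filter.Eventually.of_forall fun ω => rfl
    · by_cases hi : i ∈ A <;> simp only [hi, if_true, if_false]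
      · exact measurable_id
      · exact measurable_neg
  refine IdentDistrib.pi (fun i => ?_) h1 h2
  by_cases hi : i ∈ A <;> simp only [hi, if_true, if_false]
  · exact IdentDistrib.refl (h.measurable _).aemeasurable
  · exact (h.shift i).symm

/-- The number of nonzero terms among the first `m`. -/
noncomputable def numNonzero (X : ℕ → Ω → ℂ) (m : ℕ) (ω : Ω) : ℕ :=
  (Finset.univ.filter fun i : Fin m => X i ω ≠ 0).card

lemma numNonzero_eq_sum (m : ℕ) (ω : Ω) :
    (numNonzero X m ω : ℝ) = ∑ i ∈ Finset.range m, if X i ω ≠ 0 then (1 : ℝ) else 0 := by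
  rw [numNonzero, ← Fin.sum_univ_eq_sum_range (fun i => if X i ω ≠ 0 then (1 : ℝ) else 0) m,
    Finset.card_filter]
  push_cast
  rfl

lemma IsSymmetricNoise.measurable_numNonzero (h : IsSymmetricNoise P X) (m : ℕ) :
    Measurable (numNonzero X m) := by
  have : Measurable fun ω => (numNonzero X m ω : ℝ) := by
    simp_rw [numNonzero_eq_sum]
    refine Finset.measurable_sum _ fun i _ => ?_
    refine Measurable.ite ?_ measurable_const measurable_const
    exact (h.measurable i (measurableSet_singleton 0)).compl
  have h2 := Nat.measurable_floor.comp this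
  simpa [Function.comp_def] using h2

/-- All `2 ^ m` sign patterns give the same probability, so it equals their average. For fixed `ω`,
injectivity makes `G i (X i ω)` and `G i (-X i ω)` differ exactly where `X i ω ≠ 0`, and the count
of patterns hitting `x` is a Littlewood–Offord count over those indices. -/
lemma IsSymmetricNoise.measure_sum_eq_le (h : IsSymmetricNoise P X) {G : ℕ → ℂ → ℂ}
    (hG : ∀ i, Measurable (G i)) (hG' : ∀ i, Function.Injective (G i)) (m : ℕ) (x : ℂ) :
    P {ω | ∑ i ∈ Finset.range m, G i (X i ω) = x} ≤
      ∫⁻ ω, ENNReal.ofReal (middleRatio (numNonzero X m ω)) ∂P := by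
  classical
  have hms : ∀ A : Finset (Fin m), MeasurableSet
      {ω | ∑ i : Fin m, (if i ∈ A then G i (X i ω) else G i (- X i ω)) = x} := by
    intro A
    refine measurableSet_eq_fun (Finset.measurable_sum _ fun i _ => ?_) measurable_const
    by_cases hi : i ∈ A <;> simp only [hi, if_true, if_false]
    · exact (hG _).comp (h.measurable _)
    · exact (hG _).comp (h.measurable _).neg
  have hflip : ∀ A : Finset (Fin m), P {ω | ∑ i ∈ Finset.range m, G i (X i ω) = x} =
      P {ω | ∑ i : Fin m, (if i ∈ A then G i (X i ω) else G i (- X i ω)) = x} := by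
    intro A
    have h1 : MeasurableSet {v : Fin m → ℂ | ∑ i : Fin m, G i (v i) = x} :=
      measurableSet_eq_fun (Finset.measurable_sum _ fun i _ => (hG _).comp (measurable_pi_apply i))
        measurable_const
    have h2 := (h.identDistrib_flip A).measure_mem_eq h1
    simp only [Set.preimage_ofPred_eq] at h2
    simp_rw [apply_ite (G _)] at h2
    rw [← h2]
    congr 1
    ext ω
    simp [Finset.sum_range]
  have hcount : ∀ ω, (∑ A : Finset (Fin m), Set.indicator
      {ω | ∑ i : Fin m, (if i ∈ A then G i (X i ω) else G i (- X i ω)) = x}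
        (1 : Ω → ENNReal) ω) ≤
      2 ^ m * ENNReal.ofReal (middleRatio (numNonzero X m ω)) := by
    intro ω
    have h1 := card_choice_sum_eq_le_of_ne_on (fun i : Fin m => G i (X i ω))
      (fun i : Fin m => G i (- X i ω)) (Finset.univ.filter fun i : Fin m => X i ω ≠ 0)
      (fun i hi hne => (Finset.mem_filter.1 hi).2 (self_eq_neg.1 (hG' _ hne)))
      (fun i hi => by
        have : X i ω = 0 := by simpa using hi
        simp [this]) x
    rw [← numNonzero, Fintype.card_fin] at h1
    have hle : numNonzero X m ω ≤ m :=
      (Finset.card_filter_le _ _).trans_eq (Finset.card_fin m)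
    have h2 : (2 : ENNReal) ^ m * ENNReal.ofReal (middleRatio (numNonzero X m ω)) =
        (((numNonzero X m ω).choose (numNonzero X m ω / 2) *
          2 ^ (m - numNonzero X m ω) : ℕ) : ENNReal) := by
      rw [← ENNReal.ofReal_natCast, show (2 : ENNReal) ^ m = ENNReal.ofReal (2 ^ m) by
        rw [ENNReal.ofReal_pow (by norm_num)]; norm_num, ← ENNReal.ofReal_mul (by positivity)]
      congr 1
      rw [middleRatio]
      push_cast
      rw [pow_sub₀ _ (by norm_num) hle]
      field_simp
    rw [h2]
    refine le_trans (le_of_eq ?_) (Nat.cast_le.2 h1)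
    rw [Finset.card_filter]
    push_cast
    refine Finset.sum_congr rfl fun A _ => ?_
    simp [Set.indicator_apply]
  have htot : 2 ^ m * P {ω | ∑ i ∈ Finset.range m, G i (X i ω) = x} ≤
      2 ^ m * ∫⁻ ω, ENNReal.ofReal (middleRatio (numNonzero X m ω)) ∂P := by
    calc 2 ^ m * P {ω | ∑ i ∈ Finset.range m, G i (X i ω) = x}
        = ∑ A : Finset (Fin m), P {ω | ∑ i ∈ Finset.range m, G i (X i ω) = x} := by simp
      _ = ∑ A : Finset (Fin m),
          P {ω | ∑ i : Fin m, (if i ∈ A then G i (X i ω) else G i (- X i ω)) = x} :=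
        Finset.sum_congr rfl fun A _ => hflip A
      _ = ∑ A : Finset (Fin m), ∫⁻ ω, Set.indicator
          {ω | ∑ i : Fin m, (if i ∈ A then G i (X i ω) else G i (- X i ω)) = x} 1 ω ∂P :=
        Finset.sum_congr rfl fun A _ => (lintegral_indicator_one (hms A)).symm
      _ = ∫⁻ ω, ∑ A : Finset (Fin m), Set.indicator
          {ω | ∑ i : Fin m, (if i ∈ A then G i (X i ω) else G i (- X i ω)) = x} 1 ω ∂P :=
        (lintegral_finsetSum _ fun A _ => measurable_one.indicator (hms A)).symm
      _ ≤ ∫⁻ ω, 2 ^ m * ENNReal.ofReal (middleRatio (numNonzero X m ω)) ∂P :=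
        lintegral_mono hcount
      _ = _ := lintegral_const_mul' _ _ (by simp)
  exact (ENNReal.mul_le_mul_iff_right (by positivity) (by simp)).1 htot

/-- By the strong law, the count grows linearly at the positive rate `P(X 0 ≠ 0)`. -/
lemma IsSymmetricNoise.ae_tendsto_numNonzero (h : IsSymmetricNoise P X) :
    ∀ᵐ ω ∂P, Tendsto (fun m => numNonzero X m ω) atTop atTop := by
  have := h.isProbabilityMeasure
  let f : ℂ → ℝ := fun x => if x ≠ 0 then 1 else 0
  have hf : Measurable f :=
    Measurable.ite (measurableSet_singleton 0).compl measurable_const measurable_const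
  have hint : Integrable (fun ω => f (X 0 ω)) P := by
    refine Integrable.of_bound (hf.comp (h.measurable 0)).aestronglyMeasurable 1
      (Eventually.of_forall fun ω => ?_)
    simp only [f]
    split_ifs <;> simp
  have hslln := strong_law_ae_real (μ := P) (fun i ω => f (X i ω)) hint
    (fun i j hij => (h.indep.indepFun hij).comp hf hf) (fun i => (h.ident i).comp hf)
  have hpos : 0 < ∫ ω, f (X 0 ω) ∂P := by
    rw [integral_pos_iff_support_of_nonneg (fun ω => by simp only [f]; split_ifs <;> simp) hint]
    rw [pos_iff_ne_zero]
    intro h0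
    refine h.ne_zero ?_
    rw [ae_iff]
    convert h0 using 2
    ext ω
    simp [f]
  filter_upwards [hslln] with ω hω
  have h1 : Tendsto (fun m : ℕ => (∑ i ∈ Finset.range m, f (X i ω)) / m * m) atTop atTop :=
    Tendsto.pos_mul_atTop hpos hω tendsto_natCast_atTop_atTop
  rw [← tendsto_natCast_atTop_iff (R := ℝ)]
  refine h1.congr' ?_
  filter_upwards [eventually_gt_atTop 0] with m hm
  rw [div_mul_cancel₀ _ (by positivity), numNonzero_eq_sum]

lemma IsSymmetricNoise.tendsto_lintegral_middleRatio (h : IsSymmetricNoise P X) :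
    Tendsto (fun m => ∫⁻ ω, ENNReal.ofReal (middleRatio (numNonzero X m ω)) ∂P) atTop (𝓝 0) := by
  have := h.isProbabilityMeasure
  rw [← lintegral_zero (μ := P)]
  refine tendsto_lintegral_of_dominated_convergence (fun _ => 1) (fun m => ?_) (fun m => ?_)
    (by simp) ?_
  · exact ENNReal.measurable_ofReal.comp
      ((measurable_from_top (f := middleRatio)).comp (h.measurable_numNonzero m))
  · refine Eventually.of_forall fun ω => ?_
    simpa using middleRatio_le_one _
  · filter_upwards [h.ae_tendsto_numNonzero] with ω hω
    simpa using! ENNReal.tendsto_ofReal (tendsto_middleRatio.comp hω)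

end Anticoncentration

/-! ### Elementary symmetric functions as coefficients. -/

/-- The polynomial `∏_{i ∈ J} (1 + y_i T)`, whose coefficients are the elementary symmetric
functions of the family `(y_i)_{i ∈ J}`. -/
noncomputable def linProd (y : ℕ → ℂ) (J : Finset ℕ) : ℂ[X] := ∏ i ∈ J, (1 + C (y i) * X)

@[simp] lemma linProd_coeff_zero (y : ℕ → ℂ) (J : Finset ℕ) : (linProd y J).coeff 0 = 1 := by
  simp [linProd, coeff_zero_eq_eval_zero, eval_prod]

lemma linProd_union (y : ℕ → ℂ) {J T : Finset ℕ} (h : Disjoint J T) :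
    linProd y (J ∪ T) = linProd y J * linProd y T :=
  Finset.prod_union h

lemma linProd_insert (y : ℕ → ℂ) {J : Finset ℕ} {i : ℕ} (hi : i ∉ J) :
    linProd y (insert i J) = linProd y J * (1 + C (y i) * X) := by
  rw [linProd, Finset.prod_insert hi, mul_comm, linProd]

lemma coeff_succ_mul_one_add (p : ℂ[X]) (c : ℂ) (k : ℕ) :
    (p * (1 + C c * X)).coeff (k + 1) = p.coeff (k + 1) + c * p.coeff k := by
  rw [mul_add, mul_one, coeff_add, ← mul_assoc, coeff_mul_X, coeff_mul_C, mul_comm c]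

lemma linProd_coeff_one (y : ℕ → ℂ) (J : Finset ℕ) :
    (linProd y J).coeff 1 = ∑ i ∈ J, y i := by
  classical
  induction J using Finset.induction_on with
  | empty => simp [linProd, coeff_one]
  | insert i J hi ih =>
    rw [linProd_insert y hi, coeff_succ_mul_one_add, ih, Finset.sum_insert hi, linProd_coeff_zero]
    ring

lemma norm_linProd_coeff_le (y : ℕ → ℂ) (J : Finset ℕ) (k : ℕ) :
    ‖(linProd y J).coeff k‖ ≤ (∑ i ∈ J, ‖y i‖) ^ k := by
  classical
  induction J using Finset.induction_on generalizing k with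
  | empty =>
    rcases k with _ | k
    · simp
    · simp [linProd, coeff_one]
  | insert i J hi ih =>
    rcases k with _ | k
    · simp
    · rw [linProd_insert y hi, coeff_succ_mul_one_add, Finset.sum_insert hi]
      have hS : 0 ≤ ∑ i ∈ J, ‖y i‖ := Finset.sum_nonneg fun _ _ => norm_nonneg _
      set S := ∑ i ∈ J, ‖y i‖
      calc ‖(linProd y J).coeff (k + 1) + y i * (linProd y J).coeff k‖
          ≤ ‖(linProd y J).coeff (k + 1)‖ + ‖y i‖ * ‖(linProd y J).coeff k‖ := by
            rw [← norm_mul]; exact norm_add_le _ _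
        _ ≤ S ^ (k + 1) + ‖y i‖ * S ^ k := by gcongr <;> exact ih _
        _ = (‖y i‖ + S) * S ^ k := by ring
        _ ≤ (‖y i‖ + S) * (‖y i‖ + S) ^ k := by
            gcongr
            exact le_add_of_nonneg_left (norm_nonneg _)
        _ = _ := by ring

lemma measurable_linProd_coeff {α : Type*} [MeasurableSpace α] {Y : α → ℕ → ℂ} {J : Finset ℕ}
    (hY : ∀ i ∈ J, Measurable fun a => Y a i) (k : ℕ) :
    Measurable fun a => (linProd (Y a) J).coeff k := by
  classical
  induction J using Finset.induction_on generalizing k with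
  | empty => simp [linProd]
  | insert i J hi ih =>
    have hJ := ih fun j hj => hY j (Finset.mem_insert_of_mem hj)
    rcases k with _ | k
    · simp
    · simp_rw [linProd_insert _ hi, coeff_succ_mul_one_add]
      exact (hJ _).add ((hY i (Finset.mem_insert_self _ _)).mul (hJ k))

lemma measurable_coeff_mul {α : Type*} [MeasurableSpace α] {p q : α → ℂ[X]}
    (hp : ∀ k, Measurable fun a => (p a).coeff k) (hq : ∀ k, Measurable fun a => (q a).coeff k)
    (k : ℕ) : Measurable fun a => (p a * q a).coeff k := by
  simp_rw [coeff_mul]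
  exact Finset.measurable_sum _ fun i _ => (hp _).mul (hq _)

/-! ### Independent blocks and decoupling. -/

/-- The family that agrees with `y` on `J` and vanishes elsewhere. -/
def restrictTo (J : Finset ℕ) (y : ℕ → ℂ) (i : ℕ) : ℂ := if i ∈ J then y i else 0

lemma linProd_restrictTo (y : ℕ → ℂ) (J : Finset ℕ) : linProd (restrictTo J y) J = linProd y J :=
  Finset.prod_congr rfl fun i hi => by simp [restrictTo, hi]

lemma sum_restrictTo (y : ℕ → ℂ) (J : Finset ℕ) : ∑ i ∈ J, restrictTo J y i = ∑ i ∈ J, y i :=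
  Finset.sum_congr rfl fun i hi => by simp [restrictTo, hi]

section Decoupling

variable {Ω : Type*} [MeasurableSpace Ω] {P : Measure Ω}

lemma measurable_restrictTo {Y : ℕ → Ω → ℂ} (hY : ∀ i, Measurable (Y i)) (J : Finset ℕ) :
    Measurable fun ω => restrictTo J (fun i => Y i ω) := by
  refine measurable_pi_lambda _ fun i => ?_
  by_cases hi : i ∈ J <;> simp only [restrictTo, hi, if_true, if_false]
  · exact hY i
  · exact measurable_const

lemma indepFun_restrictTo {Y : ℕ → Ω → ℂ} (hY : ∀ i, Measurable (Y i)) (hind : iIndepFun Y P)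
    {J T : Finset ℕ} (hJT : Disjoint J T) :
    IndepFun (fun ω => restrictTo J (fun i => Y i ω)) (fun ω => restrictTo T (fun i => Y i ω)) P := by
  classical
  have hext : ∀ S : Finset ℕ,
      Measurable fun (v : S → ℂ) (i : ℕ) => if h : i ∈ S then v ⟨i, h⟩ else 0 := by
    intro S
    refine measurable_pi_lambda _ fun i => ?_
    by_cases hi : i ∈ S <;> simp only [hi, dite_true, dite_false]
    · exact measurable_pi_apply _
    · exact measurable_const
  have h := (hind.indepFun_finset J T hJT hY).comp (hext J) (hext T)
  exact h

/-- Fubini for the product law: the two independent variables may be sampled from separate copies of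
`Ω`, so no conditional expectation is needed. -/
lemma IndepFun.measure_pair_eq_lintegral [IsProbabilityMeasure P] {α β : Type*} [MeasurableSpace α]
    [MeasurableSpace β] {U : Ω → α} {V : Ω → β} (hU : Measurable U) (hV : Measurable V)
    (hUV : IndepFun U V P) {B : Set (α × β)} (hB : MeasurableSet B) :
    P {ω | (U ω, V ω) ∈ B} = ∫⁻ ω', P {ω | (U ω, V ω') ∈ B} ∂P := by
  have h1 := (indepFun_iff_map_prod_eq_prod_map_map hU.aemeasurable hV.aemeasurable).1 hUV
  rw [Measure.map_prod_map _ _ hU hV] at h1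
  have h2 := congrArg (fun m => m B) h1
  rw [Measure.map_apply (hU.prodMk hV) hB, Measure.map_apply (hU.prodMap hV) hB,
    Measure.prod_apply_symm ((hU.prodMap hV) hB)] at h2
  exact h2

lemma sq_lintegral_le [IsProbabilityMeasure P] {f : Ω → ENNReal} (hf : AEMeasurable f P) :
    (∫⁻ ω, f ω ∂P) ^ 2 ≤ ∫⁻ ω, f ω ^ 2 ∂P := by
  have h := ENNReal.lintegral_mul_le_Lp_mul_Lq P Real.HolderConjugate.two_two hf
    (aemeasurable_const (b := (1 : ENNReal)))
  simp only [Pi.mul_apply, mul_one, ENNReal.one_rpow, lintegral_const, measure_univ] at h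
  calc (∫⁻ ω, f ω ∂P) ^ 2 ≤ ((∫⁻ ω, f ω ^ (2 : ℝ) ∂P) ^ (1 / 2 : ℝ)) ^ 2 := by gcongr
    _ = ∫⁻ ω, f ω ^ (2 : ℝ) ∂P := by
      rw [← ENNReal.rpow_natCast, ← ENNReal.rpow_mul]
      norm_num
    _ = _ := by simp_rw [ENNReal.rpow_two]

/-- Decoupling by the Cauchy–Schwarz inequality. -/
lemma IndepFun.sq_measure_norm_lt_le [IsProbabilityMeasure P] {α β : Type*} [MeasurableSpace α]
    [MeasurableSpace β] {U : Ω → α} {V : Ω → β} (hU : Measurable U) (hV : Measurable V)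
    (hUV : IndepFun U V P) {F : α → β → ℂ} (hF : Measurable fun x : α × β => F x.1 x.2) (δ : ℝ) :
    P {ω | ‖F (U ω) (V ω)‖ < δ} ^ 2 ≤
      ∫⁻ x : Ω × Ω, P {ω | ‖F (U x.1) (V ω) - F (U x.2) (V ω)‖ < 2 * δ} ∂(P.prod P) := by
  have hB : MeasurableSet {x : α × β | ‖F x.1 x.2‖ < δ} :=
    measurableSet_lt hF.norm measurable_const
  have hB' : MeasurableSet {x : Ω × Ω | ‖F (U x.2) (V x.1)‖ < δ} :=
    measurableSet_lt
      (hF.comp ((hU.comp measurable_snd).prodMk (hV.comp measurable_fst))).norm measurable_const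
  have hD : MeasurableSet
      {x : Ω × (Ω × Ω) | ‖F (U x.2.1) (V x.1) - F (U x.2.2) (V x.1)‖ < 2 * δ} := by
    refine measurableSet_lt (Measurable.norm (Measurable.sub ?_ ?_)) measurable_const
    · exact hF.comp ((hU.comp (measurable_fst.comp measurable_snd)).prodMk
        (hV.comp measurable_fst))
    · exact hF.comp ((hU.comp (measurable_snd.comp measurable_snd)).prodMk
        (hV.comp measurable_fst))
  have h1 := IndepFun.measure_pair_eq_lintegral hU hV hUV hB
  simp only [Set.mem_ofPred_eq] at h1
  rw [h1]
  have hφ : Measurable fun ω' => P {ω | ‖F (U ω) (V ω')‖ < δ} :=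
    measurable_measure_prodMk_left hB'
  refine (sq_lintegral_le hφ.aemeasurable).trans ?_
  calc ∫⁻ ω', P {ω | ‖F (U ω) (V ω')‖ < δ} ^ 2 ∂P
      ≤ ∫⁻ ω', (P.prod P) {x : Ω × Ω | ‖F (U x.1) (V ω') - F (U x.2) (V ω')‖ < 2 * δ} ∂P := by
        refine lintegral_mono fun ω' => ?_
        -- With `V` frozen, the square is the probability that two independent copies of `U` both
        -- give a small value, and then their difference is below `2 * δ`.
        rw [sq, ← Measure.prod_prod]
        refine measure_mono fun x hx => ?_
        have hx1 : ‖F (U x.1) (V ω')‖ < δ := hx.1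
        have hx2 : ‖F (U x.2) (V ω')‖ < δ := hx.2
        show ‖F (U x.1) (V ω') - F (U x.2) (V ω')‖ < 2 * δ
        linarith [norm_sub_le (F (U x.1) (V ω')) (F (U x.2) (V ω'))]
    _ = (P.prod (P.prod P))
          {x : Ω × (Ω × Ω) | ‖F (U x.2.1) (V x.1) - F (U x.2.2) (V x.1)‖ < 2 * δ} :=
        (Measure.prod_apply hD).symm
    _ = _ := Measure.prod_apply_symm hD

end Decoupling

/-! ### Anti-concentration of elementary symmetric functions. -/

section Main

variable {Ω : Type*} [MeasurableSpace Ω] {P : Measure Ω} {X : ℕ → Ω → ℂ}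

/-- Differences of independent copies of long sums are rarely small. -/
lemma IsSymmetricNoise.exists_sum_sub_sum_small (h : IsSymmetricNoise P X) {G : ℕ → ℂ → ℂ}
    (hG : ∀ i, Measurable (G i)) (hG' : ∀ i, Function.Injective (G i)) (a : ℕ) {ε : ENNReal}
    (hε : ε ≠ 0) :
    ∃ b, a ≤ b ∧ ∃ η : ℝ, 0 < η ∧ (P.prod P) {x : Ω × Ω |
      ‖∑ i ∈ Finset.Ico a b, G i (X i x.1) - ∑ i ∈ Finset.Ico a b, G i (X i x.2)‖ < η} ≤ ε := by
  have := h.isProbabilityMeasure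
  obtain ⟨m, hm⟩ := (((h.shift a).tendsto_lintegral_middleRatio.eventually_lt_const
    (pos_iff_ne_zero.2 hε))).exists
  refine ⟨a + m, Nat.le_add_right _ _, ?_⟩
  set S : Ω → ℂ := fun ω => ∑ i ∈ Finset.Ico a (a + m), G i (X i ω) with hS
  have hSm : Measurable S := Finset.measurable_sum _ fun i _ => (hG i).comp (h.measurable i)
  have hdiff : Measurable fun x : Ω × Ω => ‖S x.1 - S x.2‖ :=
    ((hSm.comp measurable_fst).sub (hSm.comp measurable_snd)).norm
  have hatom : ∀ x : ℂ, P {ω | S ω = x} < ε := by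
    intro x
    refine lt_of_le_of_lt ?_ hm
    have h2 := (h.shift a).measure_sum_eq_le (fun i => hG (a + i)) (fun i => hG' (a + i)) m x
    simpa only [hS, Finset.sum_Ico_eq_sum_range, add_tsub_cancel_left] using h2
  have hzero : (P.prod P) {x : Ω × Ω | ‖S x.1 - S x.2‖ ≤ 0} < ε := by
    have hle : (P.prod P) {x : Ω × Ω | ‖S x.1 - S x.2‖ ≤ 0} ≤
        ∫⁻ ω, ENNReal.ofReal (middleRatio (numNonzero (fun i => X (a + i)) m ω)) ∂P := by
      rw [Measure.prod_apply_symm (measurableSet_le hdiff measurable_const)]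
      refine (lintegral_mono (g := fun _ => ∫⁻ ω, ENNReal.ofReal (middleRatio
        (numNonzero (fun i => X (a + i)) m ω)) ∂P) fun ω' => ?_).trans (by simp)
      have h2 := (h.shift a).measure_sum_eq_le (fun i => hG (a + i)) (fun i => hG' (a + i)) m (S ω')
      refine le_trans (measure_mono fun ω hω => ?_) h2
      have hω' : ‖S ω - S ω'‖ ≤ 0 := hω
      have h3 : S ω = S ω' := sub_eq_zero.1 (norm_le_zero_iff.1 hω')
      rw [Set.mem_ofPred_eq]
      simpa only [hS, Finset.sum_Ico_eq_sum_range, add_tsub_cancel_left] using h3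
    exact hle.trans_lt hm
  -- Continuity from above passes from the event of exact equality to a positive gap `η = 1 / (n +
  -- 1)`.
  have hlim : Tendsto (fun n : ℕ => (P.prod P) {x : Ω × Ω | ‖S x.1 - S x.2‖ ≤ 1 / ((n : ℝ) + 1)})
      atTop (𝓝 ((P.prod P) (⋂ n : ℕ, {x : Ω × Ω | ‖S x.1 - S x.2‖ ≤ 1 / ((n : ℝ) + 1)}))) := by
    refine tendsto_measure_iInter_atTop
      (fun n => (measurableSet_le hdiff measurable_const).nullMeasurableSet) ?_
      ⟨0, measure_ne_top _ _⟩
    intro n n' hn x hx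
    have hx' : ‖S x.1 - S x.2‖ ≤ 1 / ((n' : ℝ) + 1) := hx
    exact hx'.trans (one_div_le_one_div_of_le (by positivity) (by
      have : (n : ℝ) ≤ n' := Nat.cast_le.2 hn
      linarith))
  have hinter : (P.prod P) (⋂ n : ℕ, {x : Ω × Ω | ‖S x.1 - S x.2‖ ≤ 1 / ((n : ℝ) + 1)}) < ε := by
    refine lt_of_le_of_lt (measure_mono fun x hx => ?_) hzero
    refine ge_of_tendsto' (tendsto_one_div_add_atTop_nhds_zero_nat (𝕜 := ℝ)) fun n => ?_
    exact Set.mem_iInter.1 hx n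
  obtain ⟨n, hn⟩ := (hlim.eventually_lt_const hinter).exists
  refine ⟨1 / ((n : ℝ) + 1), by positivity, le_trans (measure_mono fun x hx => ?_) hn.le⟩
  exact le_of_lt (show ‖S x.1 - S x.2‖ < 1 / ((n : ℝ) + 1) from hx)

/-- Uniform anti-concentration of the coefficients of `c ∏ (1 + Y_i T)`, where `c` is any polynomial
with constant coefficient `1`. -/
lemma IsSymmetricNoise.exists_anticoncentration (h : IsSymmetricNoise P X) {G : ℕ → ℂ → ℂ}
    (hG : ∀ i, Measurable (G i)) (hG' : ∀ i, Function.Injective (G i)) (k a : ℕ) {ε : ENNReal}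
    (hε : ε ≠ 0) :
    ∃ b, a ≤ b ∧ ∃ δ : ℝ, 0 < δ ∧ ∀ c : ℂ[X], c.coeff 0 = 1 →
      P {ω | ‖(c * linProd (fun i => G i (X i ω)) (Finset.Ico a b)).coeff k‖ < δ} ≤ ε := by
  have := h.isProbabilityMeasure
  induction k generalizing a ε with
  | zero =>
    refine ⟨a, le_rfl, 1, one_pos, fun c hc => ?_⟩
    simp [mul_coeff_zero, hc]
  | succ k ih =>
    -- Decoupling bounds the square of the probability. Half of `ε ^ 2` pays for close sums over the
    -- first block, the other half for the induction hypothesis on the second.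
    have hε2 : ε ^ 2 / 2 ≠ 0 := by simp [hε]
    obtain ⟨b, hab, η, hη, hbη⟩ := h.exists_sum_sub_sum_small hG hG' a hε2
    obtain ⟨b', hbb', δ, hδ, hb'δ⟩ := ih b hε2
    refine ⟨b', hab.trans hbb', η * δ / 2, by positivity, fun c hc => ?_⟩
    set J := Finset.Ico a b
    set T := Finset.Ico b b'
    have hdisj : Disjoint J T := Finset.Ico_disjoint_Ico_consecutive a b b'
    have hunion : Finset.Ico a b' = J ∪ T := (Finset.Ico_union_Ico_eq_Ico hab hbb').symm
    have hYm : ∀ i, Measurable fun ω => G i (X i ω) := fun i => (hG i).comp (h.measurable i)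
    have hYind : iIndepFun (fun i ω => G i (X i ω)) P := h.indep.comp G hG
    set U : Ω → ℕ → ℂ := fun ω => restrictTo J (fun i => G i (X i ω)) with hU
    set V : Ω → ℕ → ℂ := fun ω => restrictTo T (fun i => G i (X i ω)) with hV
    set F : (ℕ → ℂ) → (ℕ → ℂ) → ℂ :=
      fun u v => (c * linProd u J * linProd v T).coeff (k + 1) with hF
    have hFm : Measurable fun x : (ℕ → ℂ) × (ℕ → ℂ) => F x.1 x.2 := by
      refine measurable_coeff_mul (measurable_coeff_mul (fun _ => measurable_const) ?_) ?_ _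
      · exact measurable_linProd_coeff fun i _ => (measurable_pi_apply i).comp measurable_fst
      · exact measurable_linProd_coeff fun i _ => (measurable_pi_apply i).comp measurable_snd
    have hUV : ∀ ω, (c * linProd (fun i => G i (X i ω)) (Finset.Ico a b')).coeff (k + 1) =
        F (U ω) (V ω) := by
      intro ω
      simp only [hF, hU, hV, linProd_restrictTo]
      rw [hunion, linProd_union _ hdisj, ← mul_assoc]
    simp_rw [hUV]
    have hsq := IndepFun.sq_measure_norm_lt_le (measurable_restrictTo hYm J)
      (measurable_restrictTo hYm T) (indepFun_restrictTo hYm hYind hdisj) hFm (η * δ / 2)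
    set K : Set (Ω × Ω) :=
      {x | ‖∑ i ∈ J, G i (X i x.1) - ∑ i ∈ J, G i (X i x.2)‖ < η} with hK
    have hslice : ∀ x : Ω × Ω,
        P {ω | ‖F (U x.1) (V ω) - F (U x.2) (V ω)‖ < 2 * (η * δ / 2)} ≤
        Set.indicator K 1 x +
          ε ^ 2 / 2 := by
      intro x
      by_cases hx : ‖∑ i ∈ J, G i (X i x.1) - ∑ i ∈ J, G i (X i x.2)‖ < η
      · rw [Set.indicator_of_mem (show x ∈ K from hx)]
        exact le_add_right prob_le_one
      · rw [Set.indicator_of_notMem (show x ∉ K from hx), zero_add]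
        rw [not_lt] at hx
        set d := ∑ i ∈ J, G i (X i x.1) - ∑ i ∈ J, G i (X i x.2) with hd
        have hd0 : d ≠ 0 := norm_pos_iff.1 (hη.trans_le hx)
        -- Both products have constant coefficient `1`, so their difference is divisible by the
        -- variable, which lowers the degree from `k + 1` to `k`. The quotient has constant
        -- coefficient `d`; after division by `d` it is an admissible multiplier `c`, and this is
        -- why the induction is uniform in `c`.
        set D : ℂ[X] := divX (c * (linProd (U x.1) J - linProd (U x.2) J)) with hD
        have hD0 : D.coeff 0 = d := by
          rw [hD, coeff_divX, zero_add, coeff_mul, Finset.Nat.antidiagonal_succ]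
          simp [linProd_coeff_one, hc, hU, sum_restrictTo, hd]
        have hDX : c * (linProd (U x.1) J - linProd (U x.2) J) = D * Polynomial.X := by
          conv_lhs => rw [← divX_mul_X_add (c * (linProd (U x.1) J - linProd (U x.2) J))]
          simp [hD, mul_coeff_zero]
        refine le_trans (measure_mono fun ω hω => ?_) (hb'δ (C d⁻¹ * D) (by simp [hD0, hd0]))
        have hω' : ‖F (U x.1) (V ω) - F (U x.2) (V ω)‖ < 2 * (η * δ / 2) := hω
        have hFF : F (U x.1) (V ω) - F (U x.2) (V ω) =
            d * (C d⁻¹ * D * linProd (fun i => G i (X i ω)) T).coeff k := by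
          simp only [hF]
          rw [← coeff_sub, ← sub_mul, ← mul_sub, hDX, mul_right_comm, coeff_mul_X, mul_assoc (C _),
            coeff_C_mul, ← mul_assoc, mul_inv_cancel₀ hd0, one_mul, hV, linProd_restrictTo]
        rw [hFF, norm_mul] at hω'
        show ‖(C d⁻¹ * D * linProd (fun i => G i (X i ω)) T).coeff k‖ < δ
        by_contra hcon
        rw [not_lt] at hcon
        have := mul_le_mul hx hcon hδ.le (norm_nonneg d)
        linarith
    have hmeasS : MeasurableSet K := by
      refine measurableSet_lt (Measurable.norm (Measurable.sub ?_ ?_)) measurable_const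
      · exact Finset.measurable_sum _ fun i _ => (hYm i).comp measurable_fst
      · exact Finset.measurable_sum _ fun i _ => (hYm i).comp measurable_snd
    have hfinal : P {ω | ‖F (U ω) (V ω)‖ < η * δ / 2} ^ 2 ≤ ε ^ 2 := by
      refine (hsq.trans (lintegral_mono hslice)).trans ?_
      rw [lintegral_add_right _ measurable_const, lintegral_indicator_one hmeasS]
      simp only [lintegral_const, measure_univ, mul_one]
      exact (add_le_add_left hbη _).trans_eq (ENNReal.add_halves _)
    exact (ENNReal.pow_le_pow_left_iff (by norm_num)).1 hfinal

/-- Only the first `b` factors are used for anti-concentration. The remaining factors are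
independent of them and play the role of the multiplier `c`, so `δ` does not depend on `n`. -/
lemma IsSymmetricNoise.exists_measure_coeff_lt_le (h : IsSymmetricNoise P X) {G : ℕ → ℂ → ℂ}
    (hG : ∀ i, Measurable (G i)) (hG' : ∀ i, Function.Injective (G i)) (k : ℕ) {ε : ENNReal}
    (hε : ε ≠ 0) :
    ∃ b, ∃ δ : ℝ, 0 < δ ∧ ∀ n, b ≤ n →
      P {ω | ‖(linProd (fun i => G i (X i ω)) (Finset.range n)).coeff k‖ < δ} ≤ ε := by
  have := h.isProbabilityMeasure
  obtain ⟨b, -, δ, hδ, hb⟩ := h.exists_anticoncentration hG hG' k 0 hε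
  refine ⟨b, δ, hδ, fun n hn => ?_⟩
  set J := Finset.Ico 0 b
  set T := Finset.Ico b n
  have hdisj : Disjoint J T := Finset.Ico_disjoint_Ico_consecutive 0 b n
  have hunion : Finset.range n = J ∪ T := by
    rw [Finset.range_eq_Ico]
    exact (Finset.Ico_union_Ico_eq_Ico (Nat.zero_le b) hn).symm
  have hYm : ∀ i, Measurable fun ω => G i (X i ω) := fun i => (hG i).comp (h.measurable i)
  have hYind : iIndepFun (fun i ω => G i (X i ω)) P := h.indep.comp G hG
  set U : Ω → ℕ → ℂ := fun ω => restrictTo J (fun i => G i (X i ω)) with hU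
  set V : Ω → ℕ → ℂ := fun ω => restrictTo T (fun i => G i (X i ω)) with hV
  have hB : MeasurableSet {x : (ℕ → ℂ) × (ℕ → ℂ) |
      ‖(linProd x.2 T * linProd x.1 J).coeff k‖ < δ} := by
    refine measurableSet_lt (Measurable.norm (measurable_coeff_mul ?_ ?_ _)) measurable_const
    · exact measurable_linProd_coeff fun i _ => (measurable_pi_apply i).comp measurable_snd
    · exact measurable_linProd_coeff fun i _ => (measurable_pi_apply i).comp measurable_fst
  have hUV : ∀ ω, (linProd (fun i => G i (X i ω)) (Finset.range n)).coeff k =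
      (linProd (V ω) T * linProd (U ω) J).coeff k := by
    intro ω
    simp only [hU, hV, linProd_restrictTo]
    rw [hunion, linProd_union _ hdisj, mul_comm]
  simp_rw [hUV]
  have h1 := IndepFun.measure_pair_eq_lintegral (measurable_restrictTo hYm J)
    (measurable_restrictTo hYm T) (indepFun_restrictTo hYm hYind hdisj) hB
  simp only [Set.mem_ofPred_eq] at h1
  rw [h1]
  have h3 : ∀ ω', P {ω | ‖(linProd (V ω') T * linProd (U ω) J).coeff k‖ < δ} ≤ ε := by
    intro ω'
    have hUJ : ∀ ω, linProd (U ω) J = linProd (fun i => G i (X i ω)) J :=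
      fun ω => linProd_restrictTo _ _
    simp_rw [hUJ]
    exact hb (linProd (V ω') T) (linProd_coeff_zero _ _)
  calc _ ≤ ∫⁻ _, ε ∂P := lintegral_mono h3
    _ = ε := by rw [lintegral_const, measure_univ, mul_one]

end Main

/-! ### Weak convergence and Cesàro-small perturbations. -/

section WeakConvergence

/-- A continuous cutoff function equal to `1` on the disc of radius `R`. -/
noncomputable def cutoff (R : ℝ) (w : ℂ) : ℝ := max 0 (min 1 (R + 1 - ‖w‖))

lemma continuous_cutoff (R : ℝ) : Continuous (cutoff R) := by unfold cutoff; fun_prop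

lemma cutoff_nonneg (R : ℝ) (w : ℂ) : 0 ≤ cutoff R w := le_max_left _ _

lemma cutoff_le_one (R : ℝ) (w : ℂ) : cutoff R w ≤ 1 := max_le zero_le_one (min_le_left _ _)

lemma hasCompactSupport_cutoff (R : ℝ) : HasCompactSupport (cutoff R) := by
  refine HasCompactSupport.intro (isCompact_closedBall (0 : ℂ) (R + 1)) fun w hw => ?_
  rw [mem_closedBall_zero_iff, not_le] at hw
  rw [cutoff, max_eq_left]
  exact (min_le_right _ _).trans (by linarith)

lemma tendsto_integral_cutoff (μ : ProbabilityMeasure ℂ) :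
    Tendsto (fun n : ℕ => ∫ w, cutoff n w ∂(μ : Measure ℂ)) atTop (𝓝 1) := by
  have h1 : ∫ _, (1 : ℝ) ∂(μ : Measure ℂ) = 1 := by simp
  rw [← h1]
  refine tendsto_integral_of_dominated_convergence (fun _ => 1)
    (fun n => (continuous_cutoff n).aestronglyMeasurable) (integrable_const _)
    (fun n => Eventually.of_forall fun w => ?_) (Eventually.of_forall fun w => ?_)
  · rw [Real.norm_of_nonneg (cutoff_nonneg _ _)]
    exact cutoff_le_one _ _
  · refine tendsto_const_nhds.congr' ?_
    filter_upwards [eventually_ge_atTop ⌈‖w‖⌉₊] with n hn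
    have := Nat.ceil_le.1 hn
    rw [cutoff, min_eq_left (by linarith), max_eq_right zero_le_one]

/-- Convergence of integrals of compactly supported continuous functions implies weak convergence,
provided that no mass is gained. -/
lemma tendsto_toFiniteMeasure_of_compactSupport {ι : Type*} {L : Filter ι}
    {ν : ι → FiniteMeasure ℂ} {μ : ProbabilityMeasure ℂ}
    (hmass : ∀ᶠ i in L, (ν i).mass = 1)
    (h : ∀ f : ℂ → ℝ, Continuous f → HasCompactSupport f →
      Tendsto (fun i => ∫ w, f w ∂(ν i : Measure ℂ)) L (𝓝 (∫ w, f w ∂(μ : Measure ℂ)))) :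
    Tendsto ν L (𝓝 μ.toFiniteMeasure) := by
  refine FiniteMeasure.tendsto_of_forall_integral_tendsto fun f => ?_
  rw [Metric.tendsto_nhds]
  intro ε hε
  set B : ℝ := ‖f‖ + 1
  have hB : 0 < B := by positivity
  have hfB : ∀ w, |f w| ≤ B := fun w => (f.norm_coe_le_norm w).trans (by simp [B])
  -- Each of the two tails outside the cutoff then costs at most `ε / 6`, and the compactly
  -- supported part less than `ε / 3`.
  set η : ℝ := ε / (6 * B)
  have hη : 0 < η := by positivity
  obtain ⟨R, hR⟩ := ((tendsto_integral_cutoff μ).eventually_const_lt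
    (show 1 - η < 1 by linarith)).exists
  have hχ := h (cutoff R) (continuous_cutoff R) (hasCompactSupport_cutoff R)
  have hfχ := h (fun w => f w * cutoff R w) (f.continuous.mul (continuous_cutoff R))
    (hasCompactSupport_cutoff R).mul_left
  have key : ∀ ν : Measure ℂ, IsFiniteMeasure ν → ν.real Set.univ = 1 →
      |∫ w, f w ∂ν - ∫ w, f w * cutoff R w ∂ν| ≤ B * (1 - ∫ w, cutoff R w ∂ν) := by
    intro ν _ hν
    have hi1 : Integrable (fun w => f w) ν := f.integrable ν
    have hi2 : Integrable (cutoff R) ν :=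
      (continuous_cutoff R).integrable_of_hasCompactSupport (hasCompactSupport_cutoff R)
    have hi3 : Integrable (fun w => f w * cutoff R w) ν :=
      (f.continuous.mul (continuous_cutoff R)).integrable_of_hasCompactSupport
        (hasCompactSupport_cutoff R).mul_left
    rw [← integral_sub hi1 hi3]
    calc |∫ w, (f w - f w * cutoff R w) ∂ν|
        ≤ ∫ w, |f w - f w * cutoff R w| ∂ν := abs_integral_le_integral_abs
      _ ≤ ∫ w, B * (1 - cutoff R w) ∂ν := by
        refine integral_mono (hi1.sub hi3).abs (((integrable_const _).sub hi2).const_mul _)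
          fun w => ?_
        have h0 : 0 ≤ 1 - cutoff R w := sub_nonneg.2 (cutoff_le_one R w)
        have h1 : f w - f w * cutoff R w = f w * (1 - cutoff R w) := by ring
        simp only [h1, abs_mul, abs_of_nonneg h0]
        gcongr
        exact hfB w
      _ = B * (1 - ∫ w, cutoff R w ∂ν) := by
        rw [integral_const_mul, integral_sub (integrable_const _) hi2, integral_const, hν]
        simp
  filter_upwards [hmass, hχ.eventually_const_lt hR, Metric.tendsto_nhds.1 hfχ (ε / 3) (by positivity)]
    with i hi1 hi2 hi3
  have hν := key (ν i) inferInstance (by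
    rw [measureReal_def, ← FiniteMeasure.ennreal_mass, hi1]; simp)
  have hμ := key μ inferInstance (by simp)
  rw [Real.dist_eq] at hi3 ⊢
  have e1 : B * (1 - ∫ w, cutoff R w ∂(ν i : Measure ℂ)) ≤ ε / 6 := by
    calc _ ≤ B * η := by gcongr; linarith
      _ = ε / 6 := by simp only [η]; field_simp
  have e2 : B * (1 - ∫ w, cutoff R w ∂(μ : Measure ℂ)) ≤ ε / 6 := by
    calc _ ≤ B * η := by gcongr; linarith
      _ = ε / 6 := by simp only [η]; field_simp
  rw [abs_lt] at hi3 ⊢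
  rw [abs_le] at hν hμ
  constructor
  · show -ε < ∫ w, f w ∂(ν i : Measure ℂ) - ∫ w, f w ∂(μ : Measure ℂ)
    linarith [hi3.1, hν.1, hμ.2]
  · show ∫ w, f w ∂(ν i : Measure ℂ) - ∫ w, f w ∂(μ : Measure ℂ) < ε
    linarith [hi3.2, hν.2, hμ.1]

lemma integral_sum_map_diracProba (s : Multiset ℂ) (f : ℂ → ℝ) :
    ∫ w, f w ∂((s.map fun w => (diracProba w).toFiniteMeasure).sum : FiniteMeasure ℂ) =
      (s.map f).sum ∧
    Integrable f ((s.map fun w => (diracProba w).toFiniteMeasure).sum : FiniteMeasure ℂ) := by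
  have hδ : ∀ a : ℂ, (((diracProba a).toFiniteMeasure : FiniteMeasure ℂ) : Measure ℂ) =
      Measure.dirac a := fun a => rfl
  induction s using Multiset.induction_on with
  | empty => simp
  | cons a s ih =>
    have ha : Integrable f (((diracProba a).toFiniteMeasure : FiniteMeasure ℂ) : Measure ℂ) := by
      rw [hδ]
      exact integrable_dirac (by simp)
    simp only [Multiset.map_cons, Multiset.sum_cons, FiniteMeasure.toMeasure_add]
    refine ⟨?_, ha.add_measure ih.2⟩
    rw [integral_add_measure ha ih.2, ih.1]
    congr 1
    rw [hδ, integral_dirac]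

lemma integral_zeroMeasure (p : ℂ[X]) (f : ℂ → ℝ) :
    ∫ w, f w ∂(zeroMeasure p : Measure ℂ) =
      (Multiset.card p.roots : ℝ)⁻¹ * (p.roots.map f).sum := by
  rw [zeroMeasure, FiniteMeasure.toMeasure_smul, integral_smul_nnreal_measure,
    (integral_sum_map_diracProba _ f).1, NNReal.smul_def]
  simp

lemma mass_zeroMeasure {p : ℂ[X]} (hp : 0 < Multiset.card p.roots) : (zeroMeasure p).mass = 1 := by
  have h := integral_zeroMeasure p (fun _ => (1 : ℝ))
  rw [integral_const, measureReal_def, ← FiniteMeasure.ennreal_mass] at h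
  have hp' : (Multiset.card p.roots : ℝ) ≠ 0 := by positivity
  simp [hp'] at h
  exact NNReal.eq (h.trans NNReal.coe_one.symm)

lemma zeroMeasure_prod_X_sub_C (a : ℕ → ℂ) (n : ℕ) :
    zeroMeasure (∏ i ∈ Finset.range n, (X - C (a i))) = seqEmpiricalMeasure a n := by
  have hroots : (∏ i ∈ Finset.range n, (X - C (a i))).roots = (Finset.range n).val.map a := by
    have h := Polynomial.roots_multiset_prod_X_sub_C ((Finset.range n).val.map a)
    rw [Multiset.map_map] at h
    exact h
  rw [zeroMeasure, seqEmpiricalMeasure, hroots, Multiset.map_map, Multiset.card_map]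
  simp [Finset.sum_eq_multiset_sum]

lemma integral_seqEmpiricalMeasure (a : ℕ → ℂ) (n : ℕ) (f : ℂ → ℝ) :
    ∫ w, f w ∂(seqEmpiricalMeasure a n : Measure ℂ) =
      (n : ℝ)⁻¹ * ∑ i ∈ Finset.range n, f (a i) := by
  have hroots : (∏ i ∈ Finset.range n, (X - C (a i))).roots = (Finset.range n).val.map a := by
    have h := Polynomial.roots_multiset_prod_X_sub_C ((Finset.range n).val.map a)
    rw [Multiset.map_map] at h
    exact h
  rw [← zeroMeasure_prod_X_sub_C, integral_zeroMeasure, hroots, Multiset.map_map,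
    Multiset.card_map]
  simp [Finset.sum_eq_multiset_sum]

lemma mass_seqEmpiricalMeasure (a : ℕ → ℂ) {n : ℕ} (hn : 0 < n) :
    (seqEmpiricalMeasure a n).mass = 1 := by
  have h := integral_seqEmpiricalMeasure a n (fun _ => (1 : ℝ))
  rw [integral_const, measureReal_def, ← FiniteMeasure.ennreal_mass] at h
  have hn' : (n : ℝ) ≠ 0 := by positivity
  simp [hn'] at h
  exact NNReal.eq (h.trans NNReal.coe_one.symm)

/-- A perturbation that is small in Cesàro mean preserves the limit distribution. -/
lemma IsDistributed.of_tendsto_cesaro {μ : ProbabilityMeasure ℂ} {z w : ℕ → ℂ}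
    (hz : IsDistributed μ z)
    (h : Tendsto (fun n : ℕ => (n : ℝ)⁻¹ * ∑ i ∈ Finset.range n, ‖w i - z i‖) atTop (𝓝 0)) :
    IsDistributed μ w := by
  refine tendsto_toFiniteMeasure_of_compactSupport
    ((eventually_gt_atTop 0).mono fun n hn => mass_seqEmpiricalMeasure w hn) fun f hf hfc => ?_
  have hzf := (FiniteMeasure.tendsto_iff_forall_integral_tendsto.1 hz)
    (BoundedContinuousFunction.ofNormedAddCommGroup f hf _
      (hfc.exists_bound_of_continuous hf).choose_spec)
  simp only [BoundedContinuousFunction.coe_ofNormedAddCommGroup] at hzf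
  obtain ⟨B, hB⟩ := hfc.exists_bound_of_continuous hf
  have hB0 : 0 ≤ B := (norm_nonneg _).trans (hB 0)
  have hdiff : Tendsto (fun n => ∫ x, f x ∂(seqEmpiricalMeasure w n : Measure ℂ) -
      ∫ x, f x ∂(seqEmpiricalMeasure z n : Measure ℂ)) atTop (𝓝 0) := by
    rw [Metric.tendsto_nhds]
    intro ε hε
    obtain ⟨δ, hδ, hδf⟩ := Metric.uniformContinuous_iff.1 (hfc.uniformContinuous_of_continuous hf)
      (ε / 2) (by positivity)
    -- Uniform continuity handles close points and boundedness the others. The bound is affine in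
    -- the distance, so it can be averaged.
    have hpt : ∀ x y, |f x - f y| ≤ ε / 2 + 2 * B / δ * ‖x - y‖ := by
      intro x y
      by_cases hxy : dist x y < δ
      · have h1 := (hδf hxy).le
        rw [Real.dist_eq] at h1
        exact h1.trans (le_add_of_nonneg_right (by positivity))
      · rw [not_lt, dist_eq_norm] at hxy
        have h1 : |f x - f y| ≤ 2 * B := by
          have := abs_sub (f x) (f y)
          have h2 := hB x
          have h3 := hB y
          rw [Real.norm_eq_abs] at h2 h3
          linarith
        have h2 : 2 * B ≤ 2 * B / δ * ‖x - y‖ := by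
          rw [div_mul_eq_mul_div, le_div_iff₀ hδ]
          gcongr
        linarith
    have h' := h.const_mul (2 * B / δ)
    rw [mul_zero] at h'
    filter_upwards [h'.eventually_lt_const (show 0 < ε / 2 by positivity), eventually_gt_atTop 0]
      with n hn hn0
    have hn' : (0 : ℝ) < n := Nat.cast_pos.2 hn0
    rw [Real.dist_eq, sub_zero, integral_seqEmpiricalMeasure,
      integral_seqEmpiricalMeasure, ← mul_sub, ← Finset.sum_sub_distrib, abs_mul,
      abs_of_pos (inv_pos.2 hn')]
    calc (n : ℝ)⁻¹ * |∑ i ∈ Finset.range n, (f (w i) - f (z i))|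
        ≤ (n : ℝ)⁻¹ * ∑ i ∈ Finset.range n, (ε / 2 + 2 * B / δ * ‖w i - z i‖) := by
          gcongr
          exact (Finset.abs_sum_le_sum_abs _ _).trans (Finset.sum_le_sum fun i _ => hpt _ _)
      _ = ε / 2 + 2 * B / δ * ((n : ℝ)⁻¹ * ∑ i ∈ Finset.range n, ‖w i - z i‖) := by
          rw [Finset.sum_add_distrib, ← Finset.mul_sum]
          simp
          field_simp
      _ < ε := by linarith
  have := hdiff.add hzf
  rw [zero_add] at this
  refine this.congr fun n => ?_
  ring

/-- Beyond some `N` the weights are below `η`, against convergent means of `a`; the first `N` terms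
disappear after division by `n`. -/
lemma tendsto_cesaro_mul_zero {σ a : ℕ → ℝ} (hσ0 : ∀ i, 0 ≤ σ i) (hσ : Tendsto σ atTop (𝓝 0))
    (ha0 : ∀ i, 0 ≤ a i) {c : ℝ}
    (ha : Tendsto (fun n : ℕ => (∑ i ∈ Finset.range n, a i) / n) atTop (𝓝 c)) :
    Tendsto (fun n : ℕ => (n : ℝ)⁻¹ * ∑ i ∈ Finset.range n, σ i * a i) atTop (𝓝 0) := by
  have hc0 : 0 ≤ c := ge_of_tendsto' ha fun n =>
    div_nonneg (Finset.sum_nonneg fun i _ => ha0 i) n.cast_nonneg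
  rw [Metric.tendsto_nhds]
  intro ε hε
  set η : ℝ := ε / (2 * (c + 1))
  have hη : 0 < η := by positivity
  obtain ⟨N, hN⟩ := eventually_atTop.1 (hσ.eventually_lt_const hη)
  set S : ℝ := ∑ i ∈ Finset.range N, σ i * a i
  have h1 : Tendsto (fun n : ℕ => (n : ℝ)⁻¹ * S) atTop (𝓝 0) := by
    simpa using (tendsto_inv_atTop_nhds_zero_nat (𝕜 := ℝ)).mul_const S
  filter_upwards [h1.eventually_lt_const (show 0 < ε / 2 by positivity),
    ha.eventually_lt_const (show c < c + 1 by linarith), eventually_ge_atTop N,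
    eventually_gt_atTop 0] with n hn1 hn2 hn3 hn4
  have hn' : (0 : ℝ) < n := Nat.cast_pos.2 hn4
  have hnn : 0 ≤ (n : ℝ)⁻¹ * ∑ i ∈ Finset.range n, σ i * a i :=
    mul_nonneg (inv_nonneg.2 hn'.le) (Finset.sum_nonneg fun i _ => mul_nonneg (hσ0 i) (ha0 i))
  rw [Real.dist_eq, sub_zero, abs_of_nonneg hnn]
  have hsum : ∑ i ∈ Finset.range n, σ i * a i ≤ S + η * ∑ i ∈ Finset.range n, a i := by
    rw [← Finset.sum_range_add_sum_Ico _ hn3]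
    gcongr
    rw [Finset.mul_sum]
    refine (Finset.sum_le_sum (g := fun i => η * a i) fun i hi => ?_).trans
      (Finset.sum_le_sum_of_subset_of_nonneg (fun i hi => ?_) fun i _ _ => ?_)
    · exact mul_le_mul_of_nonneg_right (hN i (Finset.mem_Ico.1 hi).1).le (ha0 i)
    · exact Finset.mem_range.2 (Finset.mem_Ico.1 hi).2
    · exact mul_nonneg hη.le (ha0 i)
  calc (n : ℝ)⁻¹ * ∑ i ∈ Finset.range n, σ i * a i
      ≤ (n : ℝ)⁻¹ * (S + η * ∑ i ∈ Finset.range n, a i) := by gcongr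
    _ = (n : ℝ)⁻¹ * S + η * ((∑ i ∈ Finset.range n, a i) / n) := by ring
    _ < ε / 2 + η * (c + 1) := add_lt_add hn1 (mul_lt_mul_of_pos_left hn2 hη)
    _ = ε := by simp only [η]; field_simp; ring

end WeakConvergence

/-! ### Convergence in probability as convergence along a filter. -/

section ProbFilter

variable {Ω : Type*} [MeasurableSpace Ω]

/-- The filter of families of events whose probability tends to one. -/
def probFilter (P : Measure Ω) : Filter (ℕ × Ω) where
  sets := {s | Tendsto (fun n => P {ω | (n, ω) ∉ s}) atTop (𝓝 0)}
  univ_sets := by simp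
  sets_of_superset := by
    intro s t hs hst
    exact tendsto_of_tendsto_of_tendsto_of_le_of_le tendsto_const_nhds hs (fun _ => zero_le)
      fun n => measure_mono fun ω hω h => hω (hst h)
  inter_sets := by
    intro s t hs ht
    have h := Tendsto.add (show Tendsto (fun n => P {ω | (n, ω) ∉ s}) atTop (𝓝 0) from hs)
      (show Tendsto (fun n => P {ω | (n, ω) ∉ t}) atTop (𝓝 0) from ht)
    rw [add_zero] at h
    refine tendsto_of_tendsto_of_tendsto_of_le_of_le tendsto_const_nhds h (fun _ => zero_le)
      fun n => ?_
    refine le_trans (measure_mono fun ω hω => ?_) (measure_union_le _ _)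
    by_contra hcon
    exact hω ⟨not_not.1 fun h => hcon (Or.inl h), not_not.1 fun h => hcon (Or.inr h)⟩

lemma mem_probFilter {P : Measure Ω} {s : Set (ℕ × Ω)} :
    s ∈ probFilter P ↔ Tendsto (fun n => P {ω | (n, ω) ∉ s}) atTop (𝓝 0) := Iff.rfl

/-- This makes the deterministic weak convergence criterion, stated for an arbitrary filter, apply
directly to random measures. -/
lemma tendstoInProbability_iff {E : Type*} [TopologicalSpace E] {P : Measure Ω} {Y : ℕ → Ω → E}
    {c : E} : TendstoInProbability P Y c ↔
      Tendsto (fun x : ℕ × Ω => Y x.1 x.2) (probFilter P) (𝓝 c) := Iff.rfl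

lemma tendsto_fst_probFilter (P : Measure Ω) : Tendsto Prod.fst (probFilter P) atTop := by
  intro s hs
  rw [mem_map, mem_probFilter]
  refine tendsto_const_nhds.congr' ?_
  filter_upwards [hs] with n hn
  simp [hn]

lemma tendsto_probFilter_of_ae {P : Measure Ω} [IsFiniteMeasure P] {Y : ℕ → Ω → ℝ} {c : ℝ}
    (hY : ∀ n, Measurable (Y n)) (h : ∀ᵐ ω ∂P, Tendsto (fun n => Y n ω) atTop (𝓝 c)) :
    Tendsto (fun x : ℕ × Ω => Y x.1 x.2) (probFilter P) (𝓝 c) := by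
  rw [Metric.tendsto_nhds]
  intro ε hε
  have h1 := tendstoInMeasure_iff_dist.1 (tendstoInMeasure_of_tendsto_ae
    (fun n => (hY n).aestronglyMeasurable) h) ε hε
  rw [Filter.Eventually, mem_probFilter]
  refine h1.congr fun n => ?_
  congr 1
  ext ω
  simp

end ProbFilter

/-! ### Logarithmic potentials, circle means and linear statistics. -/

section Potential

/-- The logarithmic potential of a finite multiset of points. -/
noncomputable def logPotential (s : Multiset ℂ) (z : ℂ) : ℝ :=
  (s.map fun ζ => Real.log ‖z - ζ‖).sum

lemma logPotential_cons (a : ℂ) (s : Multiset ℂ) :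
    logPotential (a ::ₘ s) = fun z => Real.log ‖z - a‖ + logPotential s z := by
  ext z
  simp [logPotential]

lemma measurable_logPotential (s : Multiset ℂ) : Measurable (logPotential s) := by
  induction s using Multiset.induction_on with
  | empty => exact measurable_const
  | cons a s ih =>
    rw [logPotential_cons]
    exact (Real.measurable_log.comp (measurable_id.sub_const a).norm).add ih

/-- Jensen's formula for a linear factor. -/
lemma circleAverage_log_norm_sub {c a : ℂ} {R : ℝ} (hR : 0 < R) :
    Real.circleAverage (fun z => Real.log ‖z - a‖) c R = Real.log (max R ‖c - a‖) := by
  rw [circleAverage_log_norm_sub_const_eq_log_radius_add_posLog hR.ne',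
    Real.posLog_eq_log_max_one (by positivity), ← Real.log_mul hR.ne' (by positivity),
    mul_max_of_nonneg _ _ hR.le, mul_one, mul_inv_cancel_left₀ hR.ne']

lemma circleAverage_logPotential (s : Multiset ℂ) {c : ℂ} {R : ℝ} (hR : 0 < R) :
    CircleIntegrable (logPotential s) c R ∧
    Real.circleAverage (logPotential s) c R =
      (s.map fun ζ => Real.log (max R ‖c - ζ‖)).sum := by
  induction s using Multiset.induction_on with
  | empty =>
    have h : logPotential 0 = fun _ => (0 : ℝ) := by ext; simp [logPotential]
    rw [h]
    exact ⟨circleIntegrable_const _ _ _, by simp [Real.circleAverage_const]⟩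
  | cons a s ih =>
    have ha : CircleIntegrable (fun z => Real.log ‖z - a‖) c R :=
      circleIntegrable_log_norm_sub_const R
    rw [logPotential_cons]
    refine ⟨ha.add ih.1, ?_⟩
    rw [Real.circleAverage_fun_add ha ih.1, ih.2, circleAverage_log_norm_sub hR]
    simp

/-- The difference of the potentials of the uniform measures on the circles of radii `2r` and `r`.
It is a continuous bump function. -/
noncomputable def circleBump (r : ℝ) (w : ℂ) : ℝ :=
  Real.log (max (2 * r) ‖w‖) - Real.log (max r ‖w‖)

variable {r : ℝ}

lemma continuous_circleBump (hr : 0 < r) : Continuous (circleBump r) := by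
  unfold circleBump
  refine Continuous.sub ?_ ?_
  · exact Continuous.log (by fun_prop) fun w => (lt_max_of_lt_left (by positivity)).ne'
  · exact Continuous.log (by fun_prop) fun w => (lt_max_of_lt_left hr).ne'

lemma circleBump_nonneg (hr : 0 < r) (w : ℂ) : 0 ≤ circleBump r w := by
  rw [circleBump, sub_nonneg]
  exact Real.log_le_log (lt_max_of_lt_left hr) (max_le_max_right _ (by linarith))

lemma circleBump_eq_zero (hr : 0 < r) {w : ℂ} (hw : 2 * r ≤ ‖w‖) : circleBump r w = 0 := by
  rw [circleBump, max_eq_right hw, max_eq_right (by linarith), sub_self]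

lemma hasCompactSupport_circleBump (hr : 0 < r) : HasCompactSupport (circleBump r) := by
  refine HasCompactSupport.intro (isCompact_closedBall (0 : ℂ) (2 * r)) fun w hw => ?_
  rw [mem_closedBall_zero_iff, not_le] at hw
  exact circleBump_eq_zero hr hw.le

lemma integral_circleBump_pos (hr : 0 < r) : 0 < ∫ w, circleBump r w := by
  refine (continuous_circleBump hr).integral_pos_of_hasCompactSupport_nonneg_nonzero
    (hasCompactSupport_circleBump hr) (fun w => circleBump_nonneg hr w) (x := 0) ?_
  rw [circleBump, norm_zero, max_eq_left hr.le, max_eq_left (by linarith),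
    Real.log_mul (by norm_num) hr.ne', add_sub_cancel_right]
  exact (Real.log_pos (by norm_num)).ne'

/-- The convolution of `f` with the bump `circleBump r`. -/
noncomputable def smoothing (r : ℝ) (f : ℂ → ℝ) (w : ℂ) : ℝ := ∫ a, f a * circleBump r (a - w)

variable {f : ℂ → ℝ}

lemma integrable_mul_circleBump (hr : 0 < r) (hf : Continuous f) (hfc : HasCompactSupport f)
    (w : ℂ) : Integrable fun a => f a * circleBump r (a - w) :=
  (hf.mul ((continuous_circleBump hr).comp (continuous_id.sub continuous_const))
    ).integrable_of_hasCompactSupport hfc.mul_right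

lemma abs_smoothing_sub_le (hr : 0 < r) (hf : Continuous f) (hfc : HasCompactSupport f) {ε : ℝ}
    (hε : ∀ a w, ‖a - w‖ < 2 * r → |f a - f w| ≤ ε) (w : ℂ) :
    |smoothing r f w - (∫ a, circleBump r a) * f w| ≤ ε * ∫ a, circleBump r a := by
  have hg : Integrable fun a => circleBump r (a - w) :=
    ((continuous_circleBump hr).integrable_of_hasCompactSupport
      (hasCompactSupport_circleBump hr)).comp_sub_right w
  have hgint : ∫ a, circleBump r (a - w) = ∫ a, circleBump r a :=
    integral_sub_right_eq_self (circleBump r) w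
  rw [smoothing, ← hgint, mul_comm _ (f w), ← integral_const_mul, ← integral_const_mul,
    ← integral_sub (integrable_mul_circleBump hr hf hfc w) (hg.const_mul _)]
  refine (abs_integral_le_integral_abs).trans ?_
  refine integral_mono (((integrable_mul_circleBump hr hf hfc w).sub (hg.const_mul _)).abs)
    (hg.const_mul _) fun a => ?_
  simp only
  rw [← sub_mul, abs_mul, abs_of_nonneg (circleBump_nonneg hr _)]
  by_cases h : ‖a - w‖ < 2 * r
  · exact mul_le_mul_of_nonneg_right (hε a w h) (circleBump_nonneg hr _)
  · rw [circleBump_eq_zero hr (not_lt.1 h), mul_zero, mul_zero]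

lemma sum_map_smoothing (hr : 0 < r) (hf : Continuous f) (hfc : HasCompactSupport f)
    (s : Multiset ℂ) :
    Integrable (fun a => f a * (s.map fun ζ => circleBump r (a - ζ)).sum) ∧
    (s.map (smoothing r f)).sum = ∫ a, f a * (s.map fun ζ => circleBump r (a - ζ)).sum := by
  induction s using Multiset.induction_on with
  | empty => simp
  | cons b s ih =>
    simp only [Multiset.map_cons, Multiset.sum_cons, mul_add]
    refine ⟨(integrable_mul_circleBump hr hf hfc b).add ih.1, ?_⟩
    rw [integral_add (integrable_mul_circleBump hr hf hfc b) ih.1, ih.2, smoothing]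

/-- By Fubini, a circle mean averages translates of `F` by vectors of length `ρ`. Translation
invariance bounds each translate by the integral over the enlarged disc. -/
lemma lintegral_circleAverage_le {F : ℂ → ℝ} (hF : Measurable F) {R ρ : ℝ} (hρ : 0 < ρ) :
    ∫⁻ a in Metric.closedBall 0 R, ‖Real.circleAverage F a ρ‖ₑ ≤
      ∫⁻ z in Metric.closedBall 0 (R + ρ), ‖F z‖ₑ := by
  set c : ENNReal := ‖(2 * Real.pi)⁻¹‖ₑ with hc
  set D : ENNReal := ∫⁻ z in Metric.closedBall 0 (R + ρ), ‖F z‖ₑ with hD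
  have hpt : ∀ a, ‖Real.circleAverage F a ρ‖ₑ ≤
      c * ∫⁻ θ in Set.Ioc 0 (2 * Real.pi), ‖F (circleMap a ρ θ)‖ₑ := by
    intro a
    rw [Real.circleAverage_def, enorm_smul,
      intervalIntegral.integral_of_le (by positivity)]
    gcongr
    exact enorm_integral_le_lintegral_enorm _
  have hmeas : Measurable fun x : ℂ × ℝ => ‖F (circleMap x.1 ρ x.2)‖ₑ := by
    refine (hF.comp ?_).enorm
    unfold circleMap
    fun_prop
  calc ∫⁻ a in Metric.closedBall 0 R, ‖Real.circleAverage F a ρ‖ₑ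
      ≤ ∫⁻ a in Metric.closedBall 0 R,
          c * ∫⁻ θ in Set.Ioc 0 (2 * Real.pi), ‖F (circleMap a ρ θ)‖ₑ := lintegral_mono hpt
    _ = c * ∫⁻ a in Metric.closedBall 0 R,
          ∫⁻ θ in Set.Ioc 0 (2 * Real.pi), ‖F (circleMap a ρ θ)‖ₑ :=
        lintegral_const_mul' _ _ (by rw [hc]; exact enorm_ne_top)
    _ = c * ∫⁻ θ in Set.Ioc 0 (2 * Real.pi),
          ∫⁻ a in Metric.closedBall 0 R, ‖F (circleMap a ρ θ)‖ₑ := by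
        rw [lintegral_lintegral_swap hmeas.aemeasurable]
    _ ≤ c * ∫⁻ _ in Set.Ioc 0 (2 * Real.pi), D := by
        gcongr with θ
        rw [hD, ← lintegral_indicator Metric.isClosed_closedBall.measurableSet,
          ← lintegral_indicator Metric.isClosed_closedBall.measurableSet,
          ← lintegral_add_right_eq_self
            (Set.indicator (Metric.closedBall 0 (R + ρ)) fun z => ‖F z‖ₑ) (circleMap 0 ρ θ)]
        refine lintegral_mono fun a => ?_
        by_cases ha : a ∈ Metric.closedBall (0 : ℂ) R
        · have ha' : a + circleMap 0 ρ θ ∈ Metric.closedBall (0 : ℂ) (R + ρ) := by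
            rw [mem_closedBall_zero_iff] at ha ⊢
            refine (norm_add_le _ _).trans (add_le_add ha ?_)
            simp [abs_of_pos hρ]
          rw [Set.indicator_of_mem ha, Set.indicator_of_mem ha']
          simp [circleMap]
        · rw [Set.indicator_of_notMem ha]
          exact zero_le
    _ = D := by
        rw [lintegral_const, Measure.restrict_apply_univ, Real.volume_Ioc, sub_zero, mul_comm D,
          ← mul_assoc, hc, Real.enorm_eq_ofReal (by positivity), ← ENNReal.ofReal_mul (by positivity),
          inv_mul_cancel₀ (by positivity), ENNReal.ofReal_one, one_mul]

/-- Smoothed linear statistics of two point sets differ by at most the local `L¹` distance of their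
logarithmic potentials (up to an additive constant). -/
lemma enorm_sum_smoothing_sub_le (hr : 0 < r) (hf : Continuous f) (hfc : HasCompactSupport f)
    {R B : ℝ} (hR : ∀ a, a ∉ Metric.closedBall (0 : ℂ) R → f a = 0) (hB : ∀ a, ‖f a‖ ≤ B)
    (s t : Multiset ℂ) (κ : ℝ) :
    ‖(s.map (smoothing r f)).sum - (t.map (smoothing r f)).sum‖ₑ ≤
      2 * ENNReal.ofReal B *
        ∫⁻ z in Metric.closedBall 0 (R + 2 * r), ‖κ + logPotential s z - logPotential t z‖ₑ := by
  set F : ℂ → ℝ := fun z => κ + logPotential s z - logPotential t z with hF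
  have hFm : Measurable F :=
    ((measurable_logPotential s).const_add κ).sub (measurable_logPotential t)
  have hCA : ∀ a ρ, 0 < ρ → Real.circleAverage F a ρ =
      κ + (s.map fun ζ => Real.log (max ρ ‖a - ζ‖)).sum -
        (t.map fun ζ => Real.log (max ρ ‖a - ζ‖)).sum := by
    intro a ρ hρ
    have hs := circleAverage_logPotential s (c := a) hρ
    have ht := circleAverage_logPotential t (c := a) hρ
    have hκ : CircleIntegrable (fun _ => κ) a ρ := circleIntegrable_const _ _ _
    have h1 : CircleIntegrable (fun z => κ + logPotential s z) a ρ := hκ.add hs.1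
    rw [hF, Real.circleAverage_fun_sub h1 ht.1, Real.circleAverage_fun_add hκ hs.1,
      hs.2, ht.2, Real.circleAverage_const]
  have hsum : ∀ (u : Multiset ℂ) a, (u.map fun ζ => circleBump r (a - ζ)).sum =
      (u.map fun ζ => Real.log (max (2 * r) ‖a - ζ‖)).sum -
        (u.map fun ζ => Real.log (max r ‖a - ζ‖)).sum := by
    intro u a
    rw [← Multiset.sum_map_sub]
    rfl
  have hs := sum_map_smoothing hr hf hfc s
  have ht := sum_map_smoothing hr hf hfc t
  rw [hs.2, ht.2, ← integral_sub hs.1 ht.1]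
  have h1 : ∀ a, ‖f a * (s.map fun ζ => circleBump r (a - ζ)).sum -
      f a * (t.map fun ζ => circleBump r (a - ζ)).sum‖ₑ ≤
      Set.indicator (Metric.closedBall 0 R) (fun a => ENNReal.ofReal B *
        (‖Real.circleAverage F a (2 * r)‖ₑ + ‖Real.circleAverage F a r‖ₑ)) a := by
    intro a
    by_cases ha : a ∈ Metric.closedBall (0 : ℂ) R
    · rw [Set.indicator_of_mem ha]
      -- The constant `κ` has the same mean on both circles and cancels here.
      have h2 : f a * (s.map fun ζ => circleBump r (a - ζ)).sum -
          f a * (t.map fun ζ => circleBump r (a - ζ)).sum =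
          f a * (Real.circleAverage F a (2 * r) - Real.circleAverage F a r) := by
        rw [hCA a _ (by positivity), hCA a r hr, hsum, hsum]
        ring
      rw [h2, enorm_mul]
      gcongr
      · rw [← ofReal_norm]
        exact ENNReal.ofReal_le_ofReal (hB a)
      · exact enorm_sub_le
    · rw [hR a ha]
      simp
  calc _ ≤ ∫⁻ a, ‖f a * (s.map fun ζ => circleBump r (a - ζ)).sum -
        f a * (t.map fun ζ => circleBump r (a - ζ)).sum‖ₑ := enorm_integral_le_lintegral_enorm _
    _ ≤ ∫⁻ a, Set.indicator (Metric.closedBall 0 R) (fun a => ENNReal.ofReal B *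
        (‖Real.circleAverage F a (2 * r)‖ₑ + ‖Real.circleAverage F a r‖ₑ)) a :=
      lintegral_mono h1
    _ = ENNReal.ofReal B * ∫⁻ a in Metric.closedBall 0 R,
        (‖Real.circleAverage F a (2 * r)‖ₑ + ‖Real.circleAverage F a r‖ₑ) := by
      rw [lintegral_indicator Metric.isClosed_closedBall.measurableSet,
        lintegral_const_mul' _ _ ENNReal.ofReal_ne_top]
    _ = ENNReal.ofReal B * ((∫⁻ a in Metric.closedBall 0 R, ‖Real.circleAverage F a (2 * r)‖ₑ) +
        ∫⁻ a in Metric.closedBall 0 R, ‖Real.circleAverage F a r‖ₑ) := by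
      rw [lintegral_add_left]
      simp_rw [hCA _ (2 * r) (by positivity : 0 < 2 * r)]
      have hm : ∀ u : Multiset ℂ,
          Measurable fun a : ℂ => (u.map fun ζ => Real.log (max (2 * r) ‖a - ζ‖)).sum := by
        intro u
        induction u using Multiset.induction_on with
        | empty => simp
        | cons b u ih =>
          simp only [Multiset.map_cons, Multiset.sum_cons]
          exact (Real.measurable_log.comp
            (measurable_const.max (measurable_id.sub_const b).norm)).add ih
      exact (((hm s).const_add κ).sub (hm t)).enorm
    _ ≤ ENNReal.ofReal B * ((∫⁻ z in Metric.closedBall 0 (R + 2 * r), ‖F z‖ₑ) +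
        ∫⁻ z in Metric.closedBall 0 (R + 2 * r), ‖F z‖ₑ) := by
      refine mul_le_mul' le_rfl (add_le_add
        (lintegral_circleAverage_le hFm (by positivity))
        ((lintegral_circleAverage_le hFm hr).trans
          (lintegral_mono_set (Metric.closedBall_subset_closedBall (by linarith)))))
    _ = _ := by ring

end Potential

/-! ### Uniform local integrability of `1 / |z - w|`. -/

section InverseNorm

/-- In polar coordinates the Jacobian cancels the singularity. -/
lemma lintegral_ball_inv_norm_lt_top :
    ∫⁻ z in Metric.ball (0 : ℂ) 1, ENNReal.ofReal ‖z‖⁻¹ < ⊤ := by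
  rw [← lintegral_indicator Metric.isOpen_ball.measurableSet,
    ← Complex.lintegral_comp_polarCoord_symm]
  have hle : ∀ p ∈ polarCoord.target, ENNReal.ofReal p.1 • (Set.indicator (Metric.ball (0 : ℂ) 1)
      (fun z => ENNReal.ofReal ‖z‖⁻¹) (Complex.polarCoord.symm p)) ≤
      Set.indicator (Set.Ioo (0 : ℝ) 1 ×ˢ Set.Ioo (-Real.pi) Real.pi) (fun _ => 1) p := by
    intro p hp
    rw [polarCoord_target] at hp
    have hp1 : 0 < p.1 := hp.1
    by_cases h : Complex.polarCoord.symm p ∈ Metric.ball (0 : ℂ) 1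
    · have hlt : p.1 < 1 := by
        rw [mem_ball_zero_iff, Complex.norm_polarCoord_symm, abs_of_pos hp1] at h
        exact h
      rw [Set.indicator_of_mem h, Set.indicator_of_mem
        (show p ∈ Set.Ioo (0 : ℝ) 1 ×ˢ Set.Ioo (-Real.pi) Real.pi from ⟨⟨hp1, hlt⟩, hp.2⟩),
        Complex.norm_polarCoord_symm, abs_of_pos hp1, smul_eq_mul,
        ← ENNReal.ofReal_mul hp1.le, mul_inv_cancel₀ hp1.ne', ENNReal.ofReal_one]
    · rw [Set.indicator_of_notMem h, smul_zero]
      exact zero_le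
  refine lt_of_le_of_lt (setLIntegral_mono' polarCoord.open_target.measurableSet hle) ?_
  refine lt_of_le_of_lt (setLIntegral_le_lintegral _ _) ?_
  rw [lintegral_indicator (measurableSet_Ioo.prod measurableSet_Ioo), setLIntegral_one,
    Measure.volume_eq_prod, Measure.prod_prod, Real.volume_Ioo, Real.volume_Ioo]
  exact ENNReal.mul_lt_top ENNReal.ofReal_lt_top ENNReal.ofReal_lt_top

/-- The integrals of `1 / |z - w|` over a disc are bounded uniformly in `w`. -/
lemma exists_lintegral_inv_norm_sub_le (R : ℝ) :
    ∃ C : ℝ, 0 ≤ C ∧ ∀ w : ℂ,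
      ∫⁻ z in Metric.closedBall 0 R, ENNReal.ofReal ‖z - w‖⁻¹ ≤ ENNReal.ofReal C := by
  set I := ∫⁻ z in Metric.ball (0 : ℂ) 1, ENNReal.ofReal ‖z‖⁻¹ with hI
  have hItop : I < ⊤ := lintegral_ball_inv_norm_lt_top
  have hV : volume (Metric.closedBall (0 : ℂ) R) < ⊤ := measure_closedBall_lt_top
  refine ⟨(I + volume (Metric.closedBall (0 : ℂ) R)).toReal, ENNReal.toReal_nonneg, fun w => ?_⟩
  rw [ENNReal.ofReal_toReal (ENNReal.add_lt_top.2 ⟨hItop, hV⟩).ne]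
  set g : ℂ → ENNReal := Set.indicator (Metric.ball (0 : ℂ) 1) fun z => ENNReal.ofReal ‖z‖⁻¹ with hg
  calc ∫⁻ z in Metric.closedBall 0 R, ENNReal.ofReal ‖z - w‖⁻¹
      ≤ ∫⁻ z in Metric.closedBall 0 R, (g (z - w) + 1) := by
        refine lintegral_mono fun z => ?_
        by_cases h : z - w ∈ Metric.ball (0 : ℂ) 1
        · rw [hg, Set.indicator_of_mem h]
          exact le_self_add
        · rw [hg, Set.indicator_of_notMem h, zero_add]
          rw [mem_ball_zero_iff, not_lt] at h
          rw [← ENNReal.ofReal_one]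
          exact ENNReal.ofReal_le_ofReal (inv_le_one_of_one_le₀ h)
    _ = (∫⁻ z in Metric.closedBall 0 R, g (z - w)) + volume (Metric.closedBall (0 : ℂ) R) := by
        rw [lintegral_add_right _ measurable_const, setLIntegral_one]
    _ ≤ (∫⁻ z, g (z - w)) + volume (Metric.closedBall (0 : ℂ) R) := by
        exact add_le_add (setLIntegral_le_lintegral _ _) le_rfl
    _ = I + volume (Metric.closedBall (0 : ℂ) R) := by
        rw [lintegral_sub_right_eq_self g w, hg,
          lintegral_indicator Metric.isOpen_ball.measurableSet]

end InverseNorm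

/-! ### Deterministic comparison of the potentials of a polynomial and its derivatives. -/

section Deterministic

/-- The monic polynomial with zeros `w 0, …, w (n - 1)`. -/
noncomputable def rootPoly (w : ℕ → ℂ) (n : ℕ) : ℂ[X] := ∏ i ∈ Finset.range n, (X - C (w i))

variable (w : ℕ → ℂ) {n k : ℕ}

lemma natDegree_rootPoly (n : ℕ) : (rootPoly w n).natDegree = n := by
  simp [rootPoly, natDegree_prod_of_monic _ _ fun i _ => monic_X_sub_C (w i)]

lemma monic_rootPoly (n : ℕ) : (rootPoly w n).Monic :=
  monic_prod_of_monic _ _ fun i _ => monic_X_sub_C (w i)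

lemma coeff_iterate_derivative_rootPoly (hk : k ≤ n) :
    (derivative^[k] (rootPoly w n)).coeff (n - k) = n.descFactorial k := by
  have h := (monic_rootPoly w n).coeff_natDegree
  rw [natDegree_rootPoly] at h
  rw [coeff_iterate_derivative, Nat.sub_add_cancel hk, h, nsmul_eq_mul, mul_one]

lemma natDegree_iterate_derivative_rootPoly (hk : k ≤ n) :
    (derivative^[k] (rootPoly w n)).natDegree = n - k := by
  refine le_antisymm ?_ (le_natDegree_of_ne_zero ?_)
  · simpa [natDegree_rootPoly] using natDegree_iterate_derivative (rootPoly w n) k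
  · rw [coeff_iterate_derivative_rootPoly w hk, Nat.cast_ne_zero]
    exact (Nat.descFactorial_pos.2 hk).ne'

lemma leadingCoeff_iterate_derivative_rootPoly (hk : k ≤ n) :
    (derivative^[k] (rootPoly w n)).leadingCoeff = n.descFactorial k := by
  rw [leadingCoeff, natDegree_iterate_derivative_rootPoly w hk,
    coeff_iterate_derivative_rootPoly w hk]

lemma card_roots_iterate_derivative_rootPoly (hk : k ≤ n) :
    Multiset.card (derivative^[k] (rootPoly w n)).roots = n - k := by
  rw [IsAlgClosed.card_roots_eq_natDegree, natDegree_iterate_derivative_rootPoly w hk]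

lemma iterate_derivative_rootPoly_ne_zero (hk : k ≤ n) : derivative^[k] (rootPoly w n) ≠ 0 := by
  rw [← leadingCoeff_ne_zero, leadingCoeff_iterate_derivative_rootPoly w hk, Nat.cast_ne_zero]
  exact (Nat.descFactorial_pos.2 hk).ne'

lemma log_norm_eval_eq {p : ℂ[X]} {z : ℂ} (hz : p.eval z ≠ 0) :
    Real.log ‖p.eval z‖ = Real.log ‖p.leadingCoeff‖ + logPotential p.roots z := by
  have hp : p ≠ 0 := by rintro rfl; simp at hz
  have hlc : ‖p.leadingCoeff‖ ≠ 0 := norm_ne_zero_iff.2 (leadingCoeff_ne_zero.2 hp)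
  have key : ∀ s : Multiset ℂ, (∀ ζ ∈ s, z - ζ ≠ 0) →
      ‖(s.map fun ζ => z - ζ).prod‖ ≠ 0 ∧
        Real.log ‖(s.map fun ζ => z - ζ).prod‖ = logPotential s z := by
    intro s hs
    induction s using Multiset.induction_on with
    | empty => simp [logPotential]
    | cons a s ih =>
      obtain ⟨h1, h2⟩ := ih fun ζ hζ => hs ζ (Multiset.mem_cons_of_mem hζ)
      have ha : ‖z - a‖ ≠ 0 := norm_ne_zero_iff.2 (hs a (Multiset.mem_cons_self a s))
      rw [Multiset.map_cons, Multiset.prod_cons, norm_mul, logPotential_cons]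
      exact ⟨mul_ne_zero ha h1, by rw [Real.log_mul ha h1, h2]⟩
  obtain ⟨h1, h2⟩ := key p.roots fun ζ hζ h => hz (by
    rw [sub_eq_zero.1 h]; exact (mem_roots'.1 hζ).2)
  rw [(IsAlgClosed.splits p).eval_eq_prod_roots z, norm_mul, Real.log_mul hlc h1, h2]

/-- Taylor expansion at a point that is not a zero. -/
lemma eval_iterate_derivative_rootPoly (k : ℕ) {z : ℂ} (hz : (rootPoly w n).eval z ≠ 0) :
    (derivative^[k] (rootPoly w n)).eval z = (rootPoly w n).eval z *
      (k.factorial * (linProd (fun i => (z - w i)⁻¹) (Finset.range n)).coeff k) := by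
  have hne : ∀ i ∈ Finset.range n, z - w i ≠ 0 := by
    simpa [rootPoly, eval_prod, Finset.prod_eq_zero_iff] using hz
  -- Each linear factor, shifted to `z`, is `(z - w_i) (1 + X / (z - w_i))`.
  have htaylor : taylor z (rootPoly w n) =
      C ((rootPoly w n).eval z) * linProd (fun i => (z - w i)⁻¹) (Finset.range n) := by
    have h0 : taylor z (∏ i ∈ Finset.range n, (X - C (w i))) =
        ∏ i ∈ Finset.range n, taylor z (X - C (w i)) := map_prod (taylorAlgHom z) _ _
    rw [rootPoly, h0, eval_prod, map_prod, linProd, ← Finset.prod_mul_distrib]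
    refine Finset.prod_congr rfl fun i hi => ?_
    rw [map_sub, taylor_X, taylor_C, mul_add, ← mul_assoc, ← C_mul, eval_sub,
      eval_X, eval_C, mul_inv_cancel₀ (hne i hi)]
    simp
    ring
  have h := taylor_coeff z (rootPoly w n) k
  rw [htaylor, coeff_C_mul] at h
  rw [← factorial_smul_hasseDeriv, LinearMap.smul_apply, eval_smul, nsmul_eq_mul, ← h]
  ring

lemma norm_eval_rootPoly (z : ℂ) : ‖(rootPoly w n).eval z‖ = ∏ i ∈ Finset.range n, ‖z - w i‖ := by
  simp [rootPoly, eval_prod]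

/-- Applied to `S = ∑ 1/|z - w_i|`, whose integral over a disc is of order `n`: the right side then
has integral `O(log n)`. -/
lemma posLog_le_log_add_div {S : ℝ} (hS : 0 ≤ S) (hn : 0 < n) :
    Real.posLog S ≤ Real.log n + S / n := by
  have hn' : (0 : ℝ) < n := Nat.cast_pos.2 hn
  have h1 : S = n * (S / n) := by field_simp
  have h2 : Real.posLog (S / n) ≤ S / n := by
    rw [Real.posLog_apply]
    refine max_le (by positivity) ?_
    rcases hS.eq_or_lt with h | h
    · simp [← h]
    · linarith [Real.log_le_sub_one_of_pos (div_pos h hn')]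
  calc Real.posLog S = Real.posLog (n * (S / n)) := by rw [← h1]
    _ ≤ Real.log n + Real.posLog (S / n) := Real.posLog_nat_mul
    _ ≤ _ := by linarith

/-- A quantitative form of uniform integrability: with `y = 1/|z - ζ|`, a logarithmic singularity is
a bounded part plus an arbitrarily small multiple of an integrable function. -/
lemma posLog_le_posLog_inv_add_mul {y η : ℝ} (hy : 0 ≤ y) (hη : 0 < η) :
    Real.posLog y ≤ Real.posLog η⁻¹ + η * y := by
  have h2 : Real.posLog (η * y) ≤ η * y := by
    rw [Real.posLog_apply]
    refine max_le (by positivity) ?_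
    rcases hy.eq_or_lt with h | h
    · simp [← h]
    · linarith [Real.log_le_sub_one_of_pos (mul_pos hη h)]
  calc Real.posLog y = Real.posLog (η⁻¹ * (η * y)) := by rw [inv_mul_cancel_left₀ hη.ne']
    _ ≤ Real.posLog η⁻¹ + Real.posLog (η * y) := Real.posLog_mul
    _ ≤ _ := by linarith

lemma abs_log_eq_posLog_add (x : ℝ) : |Real.log x| = Real.posLog x + Real.posLog x⁻¹ := by
  rw [Real.posLog_apply, Real.posLog_apply, Real.log_inv]
  rcases le_total 0 (Real.log x) with h | h
  · rw [abs_of_nonneg h, max_eq_right h, max_eq_left (by linarith), add_zero]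
  · rw [abs_of_nonpos h, max_eq_left h, max_eq_right (by linarith), zero_add]

/-- The set where the logarithmic derivative expression is exponentially small. -/
def smallSet (k n : ℕ) (ε : ℝ) : Set ℂ :=
  {z | k.factorial * ‖(linProd (fun i => (z - w i)⁻¹) (Finset.range n)).coeff k‖ <
    Real.exp (-(ε * n))}

/-- The leading coefficient of the derivative is at least `1` in modulus and may be dropped; the
preceding bound is summed over the zeros. -/
lemma posLog_inv_norm_eval_le {η : ℝ} (hη : 0 < η) (hk : k ≤ n) {z : ℂ}
    (hq : (derivative^[k] (rootPoly w n)).eval z ≠ 0) :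
    Real.posLog ‖(derivative^[k] (rootPoly w n)).eval z‖⁻¹ ≤ n * Real.posLog η⁻¹ +
      η * ((derivative^[k] (rootPoly w n)).roots.map fun ζ => ‖z - ζ‖⁻¹).sum := by
  have key : ∀ s : Multiset ℂ, - logPotential s z ≤ Multiset.card s * Real.posLog η⁻¹ +
      η * (s.map fun ζ => ‖z - ζ‖⁻¹).sum ∧ 0 ≤ (s.map fun ζ => ‖z - ζ‖⁻¹).sum := by
    intro s
    induction s using Multiset.induction_on with
    | empty => simp [logPotential]
    | cons a s ih =>
      rw [logPotential_cons, Multiset.card_cons, Multiset.map_cons, Multiset.sum_cons]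
      have h0 : 0 ≤ ‖z - a‖⁻¹ := by positivity
      refine ⟨?_, add_nonneg h0 ih.2⟩
      have h1 := posLog_le_posLog_inv_add_mul h0 hη
      have h2 : -Real.log ‖z - a‖ ≤ Real.posLog ‖z - a‖⁻¹ := by
        rw [Real.posLog_apply, Real.log_inv]
        exact le_max_right _ _
      push_cast
      linarith [ih.1]
  obtain ⟨h1, h2⟩ := key (derivative^[k] (rootPoly w n)).roots
  have hcard : (Multiset.card (derivative^[k] (rootPoly w n)).roots : ℝ) ≤ n := by
    rw [card_roots_iterate_derivative_rootPoly w hk]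
    exact Nat.cast_le.2 (Nat.sub_le n k)
  have h3 := mul_le_mul_of_nonneg_right hcard (Real.posLog_nonneg (x := η⁻¹))
  rw [Real.posLog_apply, Real.log_inv, log_norm_eval_eq hq,
    leadingCoeff_iterate_derivative_rootPoly w hk, Complex.norm_natCast]
  refine max_le ?_ ?_
  · have := Real.posLog_nonneg (x := η⁻¹)
    positivity
  · have : 0 ≤ Real.log (n.descFactorial k) :=
      Real.log_nonneg (by exact_mod_cast Nat.descFactorial_pos.2 hk)
    linarith

lemma posLog_norm_eval_rootPoly_le (hn : 0 < n) {z : ℂ} {R M : ℝ} (hz : ‖z‖ ≤ R)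
    (hM : Real.log 2 + Real.posLog R +
      (n : ℝ)⁻¹ * ∑ i ∈ Finset.range n, Real.posLog ‖w i‖ ≤ M) :
    Real.posLog ‖(rootPoly w n).eval z‖ ≤ n * M := by
  have hn' : (0 : ℝ) < n := Nat.cast_pos.2 hn
  rw [norm_eval_rootPoly]
  refine (Real.posLog_prod _ _).trans ?_
  calc ∑ i ∈ Finset.range n, Real.posLog ‖z - w i‖
      ≤ ∑ i ∈ Finset.range n, (Real.log 2 + Real.posLog R + Real.posLog ‖w i‖) := by
        refine Finset.sum_le_sum fun i _ => ?_
        have h1 := Real.posLog_norm_add_le z (-w i)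
        rw [← sub_eq_add_neg, norm_neg] at h1
        linarith [Real.posLog_le_posLog (norm_nonneg z) hz]
    _ = n * (Real.log 2 + Real.posLog R +
        (n : ℝ)⁻¹ * ∑ i ∈ Finset.range n, Real.posLog ‖w i‖) := by
        rw [Finset.sum_add_distrib]
        simp
        field_simp
    _ ≤ n * M := by gcongr

/-- The quantity inside is `log x` with `x = |p^{(k)}(z) / p(z)| = k! |e_k|`. Its positive part is
bounded through `|e_k| ≤ S ^ k`. Its negative part is at most `ε n` off the small set by definition;
on it, `1/x = |p| · |p^{(k)}|⁻¹` and the two factors are bounded separately. -/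
lemma abs_logPotential_sub_le (hn : 0 < n) (hk : k ≤ n) {ε η R M : ℝ} (hε : 0 ≤ ε) (hη : 0 < η)
    (hM : Real.log 2 + Real.posLog R +
      (n : ℝ)⁻¹ * ∑ i ∈ Finset.range n, Real.posLog ‖w i‖ ≤ M)
    {z : ℂ} (hz : ‖z‖ ≤ R) (hp : (rootPoly w n).eval z ≠ 0)
    (hq : (derivative^[k] (rootPoly w n)).eval z ≠ 0) :
    |Real.log (n.descFactorial k) + logPotential (derivative^[k] (rootPoly w n)).roots z -
      logPotential (rootPoly w n).roots z| ≤
    Real.posLog k.factorial + k * Real.log n + ε * n +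
      (k / n) * ∑ i ∈ Finset.range n, ‖z - w i‖⁻¹ +
      η * ((derivative^[k] (rootPoly w n)).roots.map fun ζ => ‖z - ζ‖⁻¹).sum +
      (smallSet w k n ε).indicator (fun _ => n * (M + Real.posLog η⁻¹)) z := by
  set x : ℝ := k.factorial * ‖(linProd (fun i => (z - w i)⁻¹) (Finset.range n)).coeff k‖ with hx
  have hpn : 0 < ‖(rootPoly w n).eval z‖ := norm_pos_iff.2 hp
  have hqx : ‖(derivative^[k] (rootPoly w n)).eval z‖ = ‖(rootPoly w n).eval z‖ * x := by
    rw [eval_iterate_derivative_rootPoly w k hp, norm_mul, norm_mul, Complex.norm_natCast]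
  have hqn : 0 < ‖(derivative^[k] (rootPoly w n)).eval z‖ := norm_pos_iff.2 hq
  have hx0 : 0 < x := by
    rw [hqx] at hqn
    exact pos_of_mul_pos_right hqn hpn.le
  have hlog : Real.log (n.descFactorial k) +
      logPotential (derivative^[k] (rootPoly w n)).roots z -
      logPotential (rootPoly w n).roots z = Real.log x := by
    have h1 := log_norm_eval_eq hq
    have h2 := log_norm_eval_eq hp
    rw [leadingCoeff_iterate_derivative_rootPoly w hk, Complex.norm_natCast, hqx,
      Real.log_mul hpn.ne' hx0.ne'] at h1
    rw [(monic_rootPoly w n).leadingCoeff, norm_one, Real.log_one] at h2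
    linarith
  rw [hlog, abs_log_eq_posLog_add]
  set S : ℝ := ∑ i ∈ Finset.range n, ‖z - w i‖⁻¹ with hS
  have hS0 : 0 ≤ S := Finset.sum_nonneg fun i _ => by positivity
  have hpos : Real.posLog x ≤ Real.posLog k.factorial + k * Real.log n + (k / n) * S := by
    have h1 : ‖(linProd (fun i => (z - w i)⁻¹) (Finset.range n)).coeff k‖ ≤ S ^ k := by
      refine (norm_linProd_coeff_le _ _ k).trans_eq ?_
      simp [hS]
    calc Real.posLog x ≤ Real.posLog k.factorial +
          Real.posLog ‖(linProd (fun i => (z - w i)⁻¹) (Finset.range n)).coeff k‖ :=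
          Real.posLog_mul
      _ ≤ Real.posLog k.factorial + Real.posLog (S ^ k) := by
          exact add_le_add le_rfl (Real.posLog_le_posLog (norm_nonneg _) h1)
      _ ≤ Real.posLog k.factorial + k * (Real.log n + S / n) := by
          rw [Real.posLog_pow]
          gcongr
          exact posLog_le_log_add_div hS0 hn
      _ = _ := by ring
  set T : ℝ := ((derivative^[k] (rootPoly w n)).roots.map fun ζ => ‖z - ζ‖⁻¹).sum with hT
  have hT0 : 0 ≤ T := by
    refine Multiset.sum_nonneg fun y hy => ?_
    obtain ⟨ζ, -, rfl⟩ := Multiset.mem_map.1 hy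
    positivity
  have hneg : Real.posLog x⁻¹ ≤ ε * n + η * T +
      (smallSet w k n ε).indicator (fun _ => n * (M + Real.posLog η⁻¹)) z := by
    by_cases hA : z ∈ smallSet w k n ε
    · rw [Set.indicator_of_mem hA]
      have h1 : x⁻¹ = ‖(rootPoly w n).eval z‖ *
          ‖(derivative^[k] (rootPoly w n)).eval z‖⁻¹ := by
        rw [hqx]
        field_simp
      have h2 := Real.posLog_mul (x := ‖(rootPoly w n).eval z‖)
        (y := ‖(derivative^[k] (rootPoly w n)).eval z‖⁻¹)
      rw [← h1] at h2
      have h3 := posLog_norm_eval_rootPoly_le w hn hz hM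
      have h4 := posLog_inv_norm_eval_le w hη hk hq
      have h5 : 0 ≤ ε * n := by positivity
      linarith
    · rw [Set.indicator_of_notMem hA, add_zero]
      have h1 : Real.exp (-(ε * n)) ≤ x := not_lt.1 hA
      have h2 : -(ε * n) ≤ Real.log x := (Real.le_log_iff_exp_le hx0).2 h1
      rw [Real.posLog_apply, Real.log_inv]
      refine max_le (by positivity) ?_
      have : 0 ≤ η * T := by positivity
      linarith
  linarith

lemma lintegral_sum_inv_norm_le {R C : ℝ} (hC : ∀ w : ℂ,
    ∫⁻ z in Metric.closedBall 0 R, ENNReal.ofReal ‖z - w‖⁻¹ ≤ ENNReal.ofReal C)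
    (s : Multiset ℂ) :
    ∫⁻ z in Metric.closedBall 0 R, ENNReal.ofReal (s.map fun ζ => ‖z - ζ‖⁻¹).sum ≤
      Multiset.card s * ENNReal.ofReal C := by
  induction s using Multiset.induction_on with
  | empty => simp
  | cons a s ih =>
    simp only [Multiset.map_cons, Multiset.sum_cons, Multiset.card_cons]
    have h : ∀ z : ℂ, ENNReal.ofReal (‖z - a‖⁻¹ + (s.map fun ζ => ‖z - ζ‖⁻¹).sum) =
        ENNReal.ofReal ‖z - a‖⁻¹ + ENNReal.ofReal (s.map fun ζ => ‖z - ζ‖⁻¹).sum := by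
      intro z
      refine ENNReal.ofReal_add (by positivity) (Multiset.sum_nonneg fun y hy => ?_)
      obtain ⟨ζ, -, rfl⟩ := Multiset.mem_map.1 hy
      positivity
    have hm : Measurable fun z : ℂ => ENNReal.ofReal ‖z - a‖⁻¹ :=
      ENNReal.measurable_ofReal.comp (measurable_id.sub_const a).norm.inv
    simp_rw [h]
    rw [lintegral_add_left hm]
    push_cast
    rw [add_mul, one_mul, add_comm]
    exact add_le_add ih (hC a)

lemma measurable_sum_inv_norm (s : Multiset ℂ) :
    Measurable fun z : ℂ => (s.map fun ζ => ‖z - ζ‖⁻¹).sum := by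
  induction s using Multiset.induction_on with
  | empty => simp
  | cons a s ih =>
    simp only [Multiset.map_cons, Multiset.sum_cons]
    exact (measurable_id.sub_const a).norm.inv.add ih

lemma measurableSet_smallSet (k n : ℕ) (ε : ℝ) : MeasurableSet (smallSet w k n ε) := by
  refine measurableSet_lt (Measurable.const_mul (Measurable.norm ?_) _) measurable_const
  exact measurable_linProd_coeff (fun i _ => (measurable_id.sub_const (w i)).inv) k

lemma ae_eval_ne_zero {p : ℂ[X]} (hp : p ≠ 0) : ∀ᵐ z : ℂ, p.eval z ≠ 0 := by
  have h : {z : ℂ | ¬ p.eval z ≠ 0}.Countable := by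
    refine (p.roots.toFinset.countable_toSet).mono fun z hz => ?_
    have hz' : p.eval z = 0 := not_not.1 hz
    simpa [hp] using hz'
  exact h.measure_zero _

lemma lintegral_logPotential_sub_le (hn : 0 < n) (hk : k ≤ n) {ε η R M C : ℝ} (hε : 0 ≤ ε)
    (hη : 0 < η) (hC0 : 0 ≤ C)
    (hC : ∀ w : ℂ, ∫⁻ z in Metric.closedBall 0 R, ENNReal.ofReal ‖z - w‖⁻¹ ≤ ENNReal.ofReal C)
    (hM : Real.log 2 + Real.posLog R +
      (n : ℝ)⁻¹ * ∑ i ∈ Finset.range n, Real.posLog ‖w i‖ ≤ M) :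
    ∫⁻ z in Metric.closedBall (0 : ℂ) R, ‖Real.log (n.descFactorial k) +
      logPotential (derivative^[k] (rootPoly w n)).roots z -
      logPotential (rootPoly w n).roots z‖ₑ ≤
    ENNReal.ofReal ((Real.posLog k.factorial + k * Real.log n + ε * n) *
      (volume (Metric.closedBall (0 : ℂ) R)).toReal + k * C + η * n * C) +
    ENNReal.ofReal (n * (M + Real.posLog η⁻¹)) *
      volume (smallSet w k n ε ∩ Metric.closedBall (0 : ℂ) R) := by
  set K := Metric.closedBall (0 : ℂ) R with hK
  set s := (derivative^[k] (rootPoly w n)).roots with hs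
  set t : Multiset ℂ := (Finset.range n).val.map w with ht
  set a : ℝ := Real.posLog k.factorial + k * Real.log n + ε * n with ha
  set b : ℝ := n * (M + Real.posLog η⁻¹) with hb
  have hn' : (0 : ℝ) < n := Nat.cast_pos.2 hn
  have ha0 : 0 ≤ a := by
    have h1 := Real.posLog_nonneg (x := (k.factorial : ℝ))
    have h2 := Real.log_natCast_nonneg n
    positivity
  have hsum : ∀ z : ℂ, (t.map fun ζ => ‖z - ζ‖⁻¹).sum = ∑ i ∈ Finset.range n, ‖z - w i‖⁻¹ := by
    intro z
    rw [ht, Multiset.map_map]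
    rfl
  have hpt : ∀ᵐ z : ℂ ∂(volume.restrict K), ‖Real.log (n.descFactorial k) + logPotential s z -
      logPotential (rootPoly w n).roots z‖ₑ ≤ ENNReal.ofReal a +
        ENNReal.ofReal (k / n) * ENNReal.ofReal (t.map fun ζ => ‖z - ζ‖⁻¹).sum +
        ENNReal.ofReal η * ENNReal.ofReal (s.map fun ζ => ‖z - ζ‖⁻¹).sum +
        (smallSet w k n ε).indicator (fun _ => ENNReal.ofReal b) z := by
    filter_upwards [ae_restrict_of_ae (ae_eval_ne_zero (monic_rootPoly w n).ne_zero),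
      ae_restrict_of_ae (ae_eval_ne_zero (iterate_derivative_rootPoly_ne_zero w hk)),
      ae_restrict_mem Metric.isClosed_closedBall.measurableSet] with z h1 h2 h3
    have h := abs_logPotential_sub_le w hn hk hε hη hM (mem_closedBall_zero_iff.1 h3) h1 h2
    rw [← hsum] at h
    rw [Real.enorm_eq_ofReal_abs]
    refine (ENNReal.ofReal_le_ofReal h).trans ?_
    refine ENNReal.ofReal_add_le.trans (add_le_add (ENNReal.ofReal_add_le.trans (add_le_add
      (ENNReal.ofReal_add_le.trans (add_le_add le_rfl ?_)) ?_)) ?_)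
    · rw [ENNReal.ofReal_mul (by positivity)]
    · rw [ENNReal.ofReal_mul hη.le]
    · by_cases hz : z ∈ smallSet w k n ε
      · rw [Set.indicator_of_mem hz, Set.indicator_of_mem hz]
      · rw [Set.indicator_of_notMem hz, Set.indicator_of_notMem hz, ENNReal.ofReal_zero]
  have hmt : Measurable fun z : ℂ => ENNReal.ofReal (t.map fun ζ => ‖z - ζ‖⁻¹).sum :=
    ENNReal.measurable_ofReal.comp (measurable_sum_inv_norm t)
  have hms : Measurable fun z : ℂ => ENNReal.ofReal (s.map fun ζ => ‖z - ζ‖⁻¹).sum :=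
    ENNReal.measurable_ofReal.comp (measurable_sum_inv_norm s)
  refine (lintegral_mono_ae hpt).trans ?_
  rw [lintegral_add_right _ (measurable_const.indicator (measurableSet_smallSet w k n ε)),
    lintegral_add_right _ (hms.const_mul _), lintegral_add_right _ (hmt.const_mul _),
    lintegral_const, lintegral_const_mul' _ _ ENNReal.ofReal_ne_top,
    lintegral_const_mul' _ _ ENNReal.ofReal_ne_top,
    lintegral_indicator_const (measurableSet_smallSet w k n ε), Measure.restrict_apply_univ,
    Measure.restrict_apply (measurableSet_smallSet w k n ε)]
  refine add_le_add ?_ le_rfl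
  have hV : volume K = ENNReal.ofReal (volume K).toReal :=
    (ENNReal.ofReal_toReal measure_closedBall_lt_top.ne).symm
  have e1 : ENNReal.ofReal a * volume K = ENNReal.ofReal (a * (volume K).toReal) := by
    rw [ENNReal.ofReal_mul ha0, ← hV]
  have e2 : ENNReal.ofReal (k / n) *
      ∫⁻ z in K, ENNReal.ofReal (t.map fun ζ => ‖z - ζ‖⁻¹).sum ≤ ENNReal.ofReal (k * C) := by
    calc _ ≤ ENNReal.ofReal (k / n) * (Multiset.card t * ENNReal.ofReal C) := by
          gcongr
          exact lintegral_sum_inv_norm_le hC t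
      _ = ENNReal.ofReal (k * C) := by
          rw [ht, Multiset.card_map, Finset.card_val, Finset.card_range,
            ← ENNReal.ofReal_natCast n, ← ENNReal.ofReal_mul (by positivity),
            ← ENNReal.ofReal_mul (by positivity)]
          congr 1
          field_simp
  have e3 : ENNReal.ofReal η *
      ∫⁻ z in K, ENNReal.ofReal (s.map fun ζ => ‖z - ζ‖⁻¹).sum ≤ ENNReal.ofReal (η * n * C) := by
    calc _ ≤ ENNReal.ofReal η * (Multiset.card s * ENNReal.ofReal C) := by
          gcongr
          exact lintegral_sum_inv_norm_le hC s
      _ ≤ ENNReal.ofReal η * (n * ENNReal.ofReal C) := by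
          gcongr
          rw [hs, card_roots_iterate_derivative_rootPoly w hk]
          exact Nat.sub_le n k
      _ = ENNReal.ofReal (η * n * C) := by
          rw [← ENNReal.ofReal_natCast n, ← ENNReal.ofReal_mul (by positivity),
            ← ENNReal.ofReal_mul hη.le, mul_assoc]
  have h5 : 0 ≤ a * (volume K).toReal := mul_nonneg ha0 ENNReal.toReal_nonneg
  rw [ENNReal.ofReal_add (add_nonneg h5 (by positivity)) (by positivity),
    ENNReal.ofReal_add h5 (by positivity), ← e1]
  exact add_le_add (add_le_add le_rfl e2) e3

end Deterministic

/-! ### From potentials to zero measures. -/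

section LinearStatistics

variable {f : ℂ → ℝ} {r : ℝ}

lemma abs_sum_smoothing_sub_le (hr : 0 < r) (hf : Continuous f) (hfc : HasCompactSupport f) {ε : ℝ}
    (hε : ∀ a w, ‖a - w‖ < 2 * r → |f a - f w| ≤ ε) (s : Multiset ℂ) :
    |(s.map (smoothing r f)).sum - (∫ a, circleBump r a) * (s.map f).sum| ≤
      Multiset.card s * (ε * ∫ a, circleBump r a) := by
  induction s using Multiset.induction_on with
  | empty => simp
  | cons b s ih =>
    simp only [Multiset.map_cons, Multiset.sum_cons, Multiset.card_cons]
    have hb := abs_smoothing_sub_le hr hf hfc hε b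
    push_cast
    rw [abs_le] at hb ih ⊢
    constructor <;> nlinarith [hb.1, hb.2, ih.1, ih.2]

lemma abs_sum_sub_sum_le (hr : 0 < r) (hf : Continuous f) (hfc : HasCompactSupport f) {ε D : ℝ}
    (hε : ∀ a w, ‖a - w‖ < 2 * r → |f a - f w| ≤ ε) (s t : Multiset ℂ)
    (hD : |(s.map (smoothing r f)).sum - (t.map (smoothing r f)).sum| ≤ D) :
    |(s.map f).sum - (t.map f).sum| ≤
      (Multiset.card s + Multiset.card t) * ε + D / ∫ a, circleBump r a := by
  have hc := integral_circleBump_pos hr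
  set c := ∫ a, circleBump r a
  have hs := abs_sum_smoothing_sub_le hr hf hfc hε s
  have ht := abs_sum_smoothing_sub_le hr hf hfc hε t
  have key : c * |(s.map f).sum - (t.map f).sum| ≤
      c * ((Multiset.card s + Multiset.card t) * ε + D / c) := by
    rw [mul_add, mul_div_cancel₀ _ hc.ne', ← abs_of_pos hc, ← abs_mul, abs_of_pos hc]
    rw [abs_le] at hs ht hD ⊢
    constructor <;> nlinarith [hs.1, hs.2, ht.1, ht.2, hD.1, hD.2]
  exact le_of_mul_le_mul_left key hc

lemma abs_sum_map_le {B : ℝ} (hB : ∀ a, ‖f a‖ ≤ B) (s : Multiset ℂ) :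
    |(s.map f).sum| ≤ Multiset.card s * B := by
  induction s using Multiset.induction_on with
  | empty => simp
  | cons b s ih =>
    simp only [Multiset.map_cons, Multiset.sum_cons, Multiset.card_cons]
    have := hB b
    rw [Real.norm_eq_abs] at this
    push_cast
    linarith [abs_add_le (f b) (s.map f).sum]

/-- The three errors come from the change of normalisation from `n` to `n - k`, from replacing `f`
by its smoothing, and from the distance of the potentials divided by the mass of the bump. -/
lemma abs_integral_zeroMeasure_sub_le (hr : 0 < r) (hf : Continuous f) (hfc : HasCompactSupport f)
    {ε R B τ : ℝ} (hε : ∀ a w, ‖a - w‖ < 2 * r → |f a - f w| ≤ ε)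
    (hR : ∀ a, a ∉ Metric.closedBall (0 : ℂ) R → f a = 0) (hB : ∀ a, ‖f a‖ ≤ B)
    (w : ℕ → ℂ) {n k : ℕ} (hk : k < n) (hτ : 0 ≤ τ)
    (hL : ∫⁻ z in Metric.closedBall (0 : ℂ) (R + 2 * r), ‖Real.log (n.descFactorial k) +
      logPotential (derivative^[k] (rootPoly w n)).roots z -
      logPotential (rootPoly w n).roots z‖ₑ ≤ ENNReal.ofReal (τ * n)) :
    |∫ x, f x ∂(zeroMeasure (derivative^[k] (rootPoly w n)) : Measure ℂ) -
      ∫ x, f x ∂(zeroMeasure (rootPoly w n) : Measure ℂ)| ≤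
      B * k / n + 2 * ε + 2 * B * τ / ∫ a, circleBump r a := by
  have hn : (0 : ℝ) < n := Nat.cast_pos.2 (by omega)
  have hm : (0 : ℝ) < (n : ℝ) - k := sub_pos.2 (Nat.cast_lt.2 hk)
  have hB0 : 0 ≤ B := (norm_nonneg _).trans (hB 0)
  have hε0 : 0 ≤ ε := (abs_nonneg _).trans (hε 0 0 (by simpa using hr))
  have hc := integral_circleBump_pos hr
  set c := ∫ a, circleBump r a
  set s := (derivative^[k] (rootPoly w n)).roots with hs
  set t := (rootPoly w n).roots with ht
  have hcs : (Multiset.card s : ℝ) = n - k := by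
    rw [hs, card_roots_iterate_derivative_rootPoly w hk.le, Nat.cast_sub hk.le]
  have hct : (Multiset.card t : ℝ) = n := by
    rw [ht, IsAlgClosed.card_roots_eq_natDegree, natDegree_rootPoly]
  have hD : |(s.map (smoothing r f)).sum - (t.map (smoothing r f)).sum| ≤ 2 * B * (τ * n) := by
    have h1 := (enorm_sum_smoothing_sub_le hr hf hfc hR hB s t (Real.log (n.descFactorial k))).trans
      (mul_le_mul' le_rfl hL)
    rw [Real.enorm_eq_ofReal_abs, show (2 : ENNReal) = ENNReal.ofReal 2 by norm_num,
      ← ENNReal.ofReal_mul (by norm_num), ← ENNReal.ofReal_mul (by positivity)] at h1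
    exact (ENNReal.ofReal_le_ofReal_iff (by positivity)).1 h1
  have h1 := abs_sum_sub_sum_le hr hf hfc hε s t hD
  have h2 := abs_sum_map_le hB s
  rw [integral_zeroMeasure, integral_zeroMeasure, ← hs, ← ht]
  rw [hcs] at h1 h2 ⊢
  rw [hct] at h1 ⊢
  set A := (s.map f).sum
  set A' := (t.map f).sum
  have e1 : ((n : ℝ) - k)⁻¹ * A - (n : ℝ)⁻¹ * A' =
      (k / (n * (n - k))) * A + (n : ℝ)⁻¹ * (A - A') := by
    field_simp
    ring
  have hk0 : (0 : ℝ) ≤ k := k.cast_nonneg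
  rw [e1]
  calc |(k / (n * (n - k))) * A + (n : ℝ)⁻¹ * (A - A')|
      ≤ (k / (n * ((n : ℝ) - k))) * |A| + (n : ℝ)⁻¹ * |A - A'| := by
        refine (abs_add_le _ _).trans_eq ?_
        rw [abs_mul, abs_mul, abs_of_pos (inv_pos.2 hn),
          abs_of_nonneg (show 0 ≤ (k : ℝ) / (n * (n - k)) from div_nonneg hk0 (mul_pos hn hm).le)]
    _ ≤ (k / (n * ((n : ℝ) - k))) * ((n - k) * B) +
        (n : ℝ)⁻¹ * ((n + n) * ε + 2 * B * (τ * n) / c) := by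
        refine add_le_add (mul_le_mul_of_nonneg_left h2 (div_nonneg hk0 (mul_pos hn hm).le))
          (mul_le_mul_of_nonneg_left (h1.trans ?_) (inv_nonneg.2 hn.le))
        have : ((n : ℝ) - k + n) * ε ≤ (n + n) * ε :=
          mul_le_mul_of_nonneg_right (by linarith) hε0
        linarith
    _ = B * k / n + 2 * ε + 2 * B * τ / c := by
        field_simp
        ring

end LinearStatistics

/-! ### Estimates for the perturbed zeros. -/

section Perturbation

variable {Ω : Type*} [MeasurableSpace Ω] {P : Measure Ω} {ξ : ℕ → Ω → ℂ}

/-- The randomly perturbed zeros. -/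
def perturbedZeros (z : ℕ → ℂ) (σ : ℕ → ℝ) (x : ℕ → ℂ) (i : ℕ) : ℂ := z i - σ i * x i

lemma perturbedPoly_eq_rootPoly (z : ℕ → ℂ) (σ : ℕ → ℝ) (x : ℕ → ℂ) (n : ℕ) :
    perturbedPoly z σ x n = rootPoly (perturbedZeros z σ x) n := by
  refine Finset.prod_congr rfl fun i _ => ?_
  rw [perturbedZeros, C_sub]
  ring

lemma measurable_perturbedZeros (hξ : ∀ i, Measurable (ξ i)) (z : ℕ → ℂ) (σ : ℕ → ℝ) (i : ℕ) :
    Measurable fun ω => perturbedZeros z σ (fun i => ξ i ω) i :=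
  ((hξ i).const_mul _).const_sub _

variable {z : ℕ → ℂ} {σ : ℕ → ℝ}

/-- Anti-concentration holds at a fixed level `δ`, which the threshold `exp (-(ε n))` eventually
undercuts. The maps `x ↦ (a - z_i + σ_i x)⁻¹` are injective on all of `ℂ` thanks to `σ_i ≠ 0` and
the convention `0⁻¹ = 0`. -/
lemma IsSymmetricNoise.tendsto_measure_mem_smallSet (h : IsSymmetricNoise P ξ)
    (hσ : ∀ i, 0 < σ i) (k : ℕ) {ε : ℝ} (hε : 0 < ε) (a : ℂ) :
    Tendsto (fun n => P {ω | a ∈ smallSet (perturbedZeros z σ (fun i => ξ i ω)) k n ε})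
      atTop (𝓝 0) := by
  rw [ENNReal.tendsto_nhds_zero]
  intro e he
  have hG : ∀ i, Measurable fun x : ℂ => (a - (z i - σ i * x))⁻¹ := fun i =>
    (((measurable_id.const_mul _).const_sub _).const_sub _).inv
  have hG' : ∀ i, Function.Injective fun x : ℂ => (a - (z i - σ i * x))⁻¹ := by
    intro i x y hxy
    have h1 := sub_right_injective (sub_right_injective (inv_injective hxy))
    exact mul_left_cancel₀ (Complex.ofReal_ne_zero.2 (hσ i).ne') h1
  obtain ⟨b, δ, hδ, hb⟩ := h.exists_measure_coeff_lt_le hG hG' k he.ne'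
  have hexp : Tendsto (fun n : ℕ => Real.exp (-(ε * n))) atTop (𝓝 0) :=
    Real.tendsto_exp_neg_atTop_nhds_zero.comp
      (tendsto_natCast_atTop_atTop.const_mul_atTop hε)
  filter_upwards [eventually_ge_atTop b, hexp.eventually_lt_const hδ] with n hn hn2
  refine le_trans (measure_mono fun ω hω => ?_) (hb n hn)
  have h1 : k.factorial * ‖(linProd (fun i => (a - perturbedZeros z σ (fun i => ξ i ω) i)⁻¹)
    (Finset.range n)).coeff k‖ < Real.exp (-(ε * n)) := hω
  have h2 : (1 : ℝ) ≤ k.factorial := Nat.one_le_cast.2 k.factorial_pos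
  exact lt_of_le_of_lt (le_mul_of_one_le_left (norm_nonneg _) h2) (h1.trans hn2)

/-- By Fubini, the expected area is the integral over the disc of the pointwise probabilities, which
tends to `0` by dominated convergence; Markov's inequality concludes. -/
lemma IsSymmetricNoise.tendsto_volume_smallSet (h : IsSymmetricNoise P ξ)
    (hσ : ∀ i, 0 < σ i) (k : ℕ) {ε : ℝ} (hε : 0 < ε) (R : ℝ) :
    Tendsto (fun x : ℕ × Ω => volume (smallSet (perturbedZeros z σ (fun i => ξ i x.2)) k x.1 ε ∩
      Metric.closedBall (0 : ℂ) R)) (probFilter P) (𝓝 0) := by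
  have := h.isProbabilityMeasure
  set K := Metric.closedBall (0 : ℂ) R
  set W : Ω → ℕ → ℂ := fun ω => perturbedZeros z σ (fun i => ξ i ω) with hW
  have hKtop : volume K < ⊤ := measure_closedBall_lt_top
  have : IsFiniteMeasure (volume.restrict K) := ⟨by simpa using hKtop⟩
  have hmeas : ∀ n, MeasurableSet {x : Ω × ℂ | x.2 ∈ smallSet (W x.1) k n ε} := by
    intro n
    refine measurableSet_lt (Measurable.const_mul (Measurable.norm ?_) _) measurable_const
    refine measurable_linProd_coeff (fun i _ => Measurable.inv ?_) k
    exact measurable_snd.sub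
      ((measurable_perturbedZeros h.measurable z σ i).comp measurable_fst)
  have hslice : ∀ n ω, volume (smallSet (W ω) k n ε ∩ K) =
      (volume.restrict K) (smallSet (W ω) k n ε) := fun n ω =>
    (Measure.restrict_apply (measurableSet_smallSet _ _ _ _)).symm
  have hmean : ∀ n, ∫⁻ ω, volume (smallSet (W ω) k n ε ∩ K) ∂P =
      ∫⁻ a in K, P {ω | a ∈ smallSet (W ω) k n ε} := by
    intro n
    simp_rw [hslice]
    exact (Measure.prod_apply (hmeas n)).symm.trans (Measure.prod_apply_symm (hmeas n))
  have hlim : Tendsto (fun n => ∫⁻ ω, volume (smallSet (W ω) k n ε ∩ K) ∂P) atTop (𝓝 0) := by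
    simp_rw [hmean]
    rw [← lintegral_zero (μ := volume.restrict K)]
    refine tendsto_lintegral_of_dominated_convergence (fun _ => 1) (fun n => ?_) (fun n => ?_)
      (by simpa using hKtop.ne) (Eventually.of_forall fun a => ?_)
    · exact measurable_measure_prodMk_right (hmeas n)
    · exact Eventually.of_forall fun a => prob_le_one
    · exact h.tendsto_measure_mem_smallSet hσ k hε a
  rw [ENNReal.tendsto_nhds_zero]
  intro c hc
  by_cases hctop : c = ⊤
  · simp [hctop]
  rw [Filter.Eventually, mem_probFilter]
  have hlim' := ENNReal.Tendsto.div_const hlim (Or.inr hc.ne')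
  rw [ENNReal.zero_div] at hlim'
  refine tendsto_of_tendsto_of_tendsto_of_le_of_le tendsto_const_nhds hlim' (fun _ => zero_le)
    fun n => ?_
  have hm : Measurable fun ω => volume (smallSet (W ω) k n ε ∩ K) := by
    simp_rw [hslice]
    exact measurable_measure_prodMk_left (hmeas n)
  refine le_trans (measure_mono fun ω hω => ?_) (meas_ge_le_lintegral_div hm.aemeasurable hc.ne' hctop)
  exact (not_le.1 (show ¬ volume (smallSet (W ω) k n ε ∩ K) ≤ c from hω)).le

lemma tendsto_cesaro_norm_perturbation [IsProbabilityMeasure P] (hind : iIndepFun ξ P)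
    (hid : ∀ i, IdentDistrib (ξ i) (ξ 0) P P) (hint : Integrable (ξ 0) P)
    (hσ : ∀ i, 0 < σ i) (hσ_lim : Tendsto σ atTop (𝓝 0)) :
    ∀ᵐ ω ∂P, Tendsto (fun n : ℕ => (n : ℝ)⁻¹ * ∑ i ∈ Finset.range n, σ i * ‖ξ i ω‖)
      atTop (𝓝 0) := by
  have h := strong_law_ae_real (μ := P) (fun i ω => ‖ξ i ω‖) hint.norm
    (fun i j hij => (hind.indepFun hij).comp measurable_norm measurable_norm)
    (fun i => (hid i).comp measurable_norm)
  filter_upwards [h] with ω hω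
  exact tendsto_cesaro_mul_zero (fun i => (hσ i).le) hσ_lim (fun i => norm_nonneg _) hω

lemma cesaro_posLog_perturbedZeros_le {x : ℕ → ℂ} (hσ : ∀ i, 0 < σ i) {C : ℝ} {n : ℕ} (hn : 0 < n)
    (hC : (n : ℝ)⁻¹ * ∑ i ∈ Finset.range n, Real.posLog ‖z i‖ ≤ C)
    (hx : (n : ℝ)⁻¹ * ∑ i ∈ Finset.range n, σ i * ‖x i‖ ≤ 1) :
    (n : ℝ)⁻¹ * ∑ i ∈ Finset.range n, Real.posLog ‖perturbedZeros z σ x i‖ ≤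
      Real.log 2 + C + 1 := by
  have hn' : (0 : ℝ) < n := Nat.cast_pos.2 hn
  have hpt : ∀ i, Real.posLog ‖perturbedZeros z σ x i‖ ≤
      Real.log 2 + Real.posLog ‖z i‖ + σ i * ‖x i‖ := by
    intro i
    have h1 := Real.posLog_norm_add_le (z i) (-(σ i * x i))
    rw [← sub_eq_add_neg, norm_neg, norm_mul, Complex.norm_real, Real.norm_of_nonneg (hσ i).le]
      at h1
    have h2 := posLog_le_posLog_inv_add_mul (mul_nonneg (hσ i).le (norm_nonneg (x i))) one_pos
    rw [inv_one, Real.posLog_one] at h2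
    rw [perturbedZeros]
    linarith
  calc (n : ℝ)⁻¹ * ∑ i ∈ Finset.range n, Real.posLog ‖perturbedZeros z σ x i‖
      ≤ (n : ℝ)⁻¹ * ∑ i ∈ Finset.range n,
          (Real.log 2 + Real.posLog ‖z i‖ + σ i * ‖x i‖) := by
        gcongr with i
        exact hpt i
    _ = Real.log 2 + (n : ℝ)⁻¹ * ∑ i ∈ Finset.range n, Real.posLog ‖z i‖ +
          (n : ℝ)⁻¹ * ∑ i ∈ Finset.range n, σ i * ‖x i‖ := by
        rw [Finset.sum_add_distrib, Finset.sum_add_distrib]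
        simp
        field_simp
    _ ≤ _ := by linarith

lemma IsSymmetricNoise.eventually_lintegral_logPotential_sub_le (h : IsSymmetricNoise P ξ)
    (hint : Integrable (ξ 0) P) (hz_log : IsLogCesaroBounded z)
    (hσ : ∀ i, 0 < σ i) (hσ_lim : Tendsto σ atTop (𝓝 0)) (k : ℕ) (R : ℝ) {τ : ℝ} (hτ : 0 < τ) :
    ∀ᶠ x : ℕ × Ω in probFilter P,
      ∫⁻ a in Metric.closedBall (0 : ℂ) R, ‖Real.log (x.1.descFactorial k) +
        logPotential (derivative^[k]
          (rootPoly (perturbedZeros z σ (fun i => ξ i x.2)) x.1)).roots a -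
        logPotential (rootPoly (perturbedZeros z σ (fun i => ξ i x.2)) x.1).roots a‖ₑ ≤
      ENNReal.ofReal (τ * x.1) := by
  have := h.isProbabilityMeasure
  obtain ⟨C, hC0, hC⟩ := exists_lintegral_inv_norm_sub_le R
  obtain ⟨Cz, hCz⟩ := hz_log
  set V := (volume (Metric.closedBall (0 : ℂ) R)).toReal with hV
  have hV0 : 0 ≤ V := ENNReal.toReal_nonneg
  set M := Real.log 2 + Real.posLog R + (Real.log 2 + Cz + 1) with hM
  -- Error budget in units of `τ n`: `1/8` each for the `ε` and `η` terms, `1/4` for the `O(log n)`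
  -- terms and `1/4` for the small set.
  set ε := τ / (8 * (V + 1)) with hεdef
  set η := τ / (8 * (C + 1)) with hηdef
  have hε : 0 < ε := by positivity
  have hη : 0 < η := by positivity
  set Q := |M + Real.posLog η⁻¹| + 1 with hQ
  have hQ0 : 0 < Q := by positivity
  have hsmall := ENNReal.tendsto_nhds_zero.1 (h.tendsto_volume_smallSet (z := z) hσ k hε R)
    (ENNReal.ofReal (τ / (4 * Q))) (by simp; positivity)
  have hmean := (tendsto_probFilter_of_ae
    (Y := fun n ω => (n : ℝ)⁻¹ * ∑ i ∈ Finset.range n, σ i * ‖ξ i ω‖) (fun n =>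
      (Finset.measurable_sum _ fun i _ => (h.measurable i).norm.const_mul _).const_mul _)
    (tendsto_cesaro_norm_perturbation h.indep h.ident hint hσ hσ_lim)).eventually_le_const one_pos
  have hfst := tendsto_fst_probFilter P
  have hlim1 : Tendsto (fun n : ℕ => (Real.posLog k.factorial * V + k * C) * (n : ℝ)⁻¹ +
      k * V * (Real.log n / n)) atTop (𝓝 0) := by
    have h1 := (tendsto_inv_atTop_nhds_zero_nat (𝕜 := ℝ)).const_mul
      (Real.posLog k.factorial * V + k * C)
    have h2 : Tendsto (fun n : ℕ => Real.log n / n) atTop (𝓝 0) := by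
      have := Real.isLittleO_log_id_atTop.tendsto_div_nhds_zero
      exact this.comp tendsto_natCast_atTop_atTop
    have h3 := h1.add (h2.const_mul (k * V))
    simpa using h3
  filter_upwards [hsmall, hmean, hfst.eventually_ge_atTop k, hfst.eventually_gt_atTop 0,
    hfst.eventually (hlim1.eventually_le_const (show 0 < τ / 4 by positivity))]
    with x hx1 hx2 hx3 hx4 hx5
  set n := x.1
  have hn' : (0 : ℝ) < n := Nat.cast_pos.2 hx4
  have hMn := cesaro_posLog_perturbedZeros_le hσ hx4 (hCz n hx4) hx2
  refine (lintegral_logPotential_sub_le (perturbedZeros z σ (fun i => ξ i x.2)) hx4 hx3 hε.le hη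
    hC0 hC (M := M) (by linarith)).trans ?_
  have hb : ENNReal.ofReal (n * (M + Real.posLog η⁻¹)) *
      volume (smallSet (perturbedZeros z σ (fun i => ξ i x.2)) k n ε ∩
        Metric.closedBall (0 : ℂ) R) ≤ ENNReal.ofReal (τ / 4 * n) := by
    calc _ ≤ ENNReal.ofReal (n * Q) * ENNReal.ofReal (τ / (4 * Q)) := by
          refine mul_le_mul' (ENNReal.ofReal_le_ofReal ?_) hx1
          gcongr
          linarith [le_abs_self (M + Real.posLog η⁻¹)]
      _ = ENNReal.ofReal (τ / 4 * n) := by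
          rw [← ENNReal.ofReal_mul (by positivity)]
          congr 1
          field_simp
  have ha : (Real.posLog k.factorial + k * Real.log n + ε * n) * V + k * C + η * n * C ≤
      τ / 2 * n := by
    have e1 : (Real.posLog k.factorial * V + k * C) + k * V * Real.log n ≤ τ / 4 * n := by
      have := mul_le_mul_of_nonneg_right hx5 hn'.le
      refine le_trans (le_of_eq ?_) this
      field_simp
    have e2 : ε * V ≤ τ / 8 := by
      rw [hεdef, div_mul_eq_mul_div, div_le_div_iff₀ (by positivity) (by norm_num)]
      nlinarith
    have e3 : η * C ≤ τ / 8 := by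
      rw [hηdef, div_mul_eq_mul_div, div_le_div_iff₀ (by positivity) (by norm_num)]
      nlinarith
    have e4 := mul_le_mul_of_nonneg_right e2 hn'.le
    have e5 := mul_le_mul_of_nonneg_right e3 hn'.le
    nlinarith
  refine (add_le_add (ENNReal.ofReal_le_ofReal ha) hb).trans ?_
  rw [← ENNReal.ofReal_add (by positivity) (by positivity)]
  refine ENNReal.ofReal_le_ofReal ?_
  nlinarith

lemma IsSymmetricNoise.tendsto_integral_zeroMeasure_sub (h : IsSymmetricNoise P ξ)
    (hint : Integrable (ξ 0) P) (hz_log : IsLogCesaroBounded z)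
    (hσ : ∀ i, 0 < σ i) (hσ_lim : Tendsto σ atTop (𝓝 0)) (k : ℕ) {f : ℂ → ℝ}
    (hf : Continuous f) (hfc : HasCompactSupport f) :
    Tendsto (fun x : ℕ × Ω =>
      ∫ a, f a ∂(zeroMeasure (derivative^[k]
        (rootPoly (perturbedZeros z σ (fun i => ξ i x.2)) x.1)) : Measure ℂ) -
      ∫ a, f a ∂(zeroMeasure (rootPoly (perturbedZeros z σ (fun i => ξ i x.2)) x.1) : Measure ℂ))
      (probFilter P) (𝓝 0) := by
  rw [Metric.tendsto_nhds]
  intro e he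
  obtain ⟨B, hB⟩ := hfc.exists_bound_of_continuous hf
  have hB0 : 0 ≤ B := (norm_nonneg _).trans (hB 0)
  obtain ⟨R, hR⟩ := hfc.isCompact.isBounded.subset_closedBall (0 : ℂ)
  have hR' : ∀ a, a ∉ Metric.closedBall (0 : ℂ) R → f a = 0 := fun a ha =>
    image_eq_zero_of_notMem_tsupport fun h' => ha (hR h')
  obtain ⟨δ, hδ, hδf⟩ := Metric.uniformContinuous_iff.1 (hfc.uniformContinuous_of_continuous hf)
    (e / 8) (by positivity)
  set r := δ / 2 with hr
  have hr0 : 0 < r := by positivity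
  have hε : ∀ a w, ‖a - w‖ < 2 * r → |f a - f w| ≤ e / 8 := by
    intro a w haw
    have h1 := (hδf (a := a) (b := w) (by rw [dist_eq_norm]; linarith)).le
    rwa [Real.dist_eq] at h1
  have hc := integral_circleBump_pos hr0
  set c := ∫ a, circleBump r a
  -- The potential term is then at most `e / 4`. Smoothing costs `2 * (e / 8)`, and the change of
  -- normalisation is eventually below `e / 4`.
  set τ := e * c / (8 * (B + 1)) with hτdef
  have hτ : 0 < τ := by positivity
  have hfst := tendsto_fst_probFilter P
  have hlim : Tendsto (fun n : ℕ => B * k / n) atTop (𝓝 0) :=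
    tendsto_const_div_atTop_nhds_zero_nat _
  filter_upwards [h.eventually_lintegral_logPotential_sub_le hint hz_log hσ hσ_lim k (R + 2 * r) hτ,
    hfst.eventually_gt_atTop k,
    hfst.eventually (hlim.eventually_lt_const (show 0 < e / 4 by positivity))] with x hx1 hx2 hx3
  rw [Real.dist_eq, sub_zero]
  refine (abs_integral_zeroMeasure_sub_le hr0 hf hfc hε hR' hB _ hx2 hτ.le hx1).trans_lt ?_
  have h1 : 2 * B * τ / c ≤ e / 4 := by
    rw [hτdef]
    have : 2 * B * (e * c / (8 * (B + 1))) / c = (e / 4) * (B / (B + 1)) := by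
      field_simp
      ring
    rw [this]
    refine mul_le_of_le_one_right (by positivity) ?_
    rw [div_le_one (by positivity)]
    linarith
  have hx3' : B * k / (x.1 : ℝ) < e / 4 := hx3
  change B * k / (x.1 : ℝ) + 2 * (e / 8) + 2 * B * τ / c < e
  linarith

end Perturbation

/-! ### Conclusion. -/

theorem mainTheorem7 {Ω : Type*} [MeasurableSpace Ω] (P : Measure Ω) [IsProbabilityMeasure P]
    (μ : ProbabilityMeasure ℂ) (z : ℕ → ℂ)
    (hz : IsDistributed μ z) (hz_log : IsLogCesaroBounded z)
    (ξ : ℕ → Ω → ℂ) (hξ_meas : ∀ i, Measurable (ξ i))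
    (hξ_indep : iIndepFun ξ P) (hξ_ident : ∀ i, IdentDistrib (ξ i) (ξ 0) P P)
    (hξ_symm : IdentDistrib (ξ 0) (fun ω => -ξ 0 ω) P P)
    (hξ_ne : ¬ (∀ᵐ ω ∂P, ξ 0 ω = 0))
    (hξ_int : Integrable (ξ 0) P)
    (σ : ℕ → ℝ) (hσ_pos : ∀ i, 0 < σ i) (hσ_anti : Antitone σ)
    (hσ_lim : Tendsto σ atTop (𝓝 0)) :
    (∀ᵐ ω ∂P, Tendsto (fun n => zeroMeasure (perturbedPoly z σ (fun i => ξ i ω) n)) atTop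
      (𝓝 μ.toFiniteMeasure)) ∧
    ∀ k : ℕ, TendstoInProbability P
      (fun n ω => zeroMeasure (derivative^[k] (perturbedPoly z σ (fun i => ξ i ω) n)))
      μ.toFiniteMeasure := by
  have h : IsSymmetricNoise P ξ := ⟨hξ_meas, hξ_indep, hξ_ident, hξ_symm, hξ_ne⟩
  simp_rw [perturbedPoly_eq_rootPoly]
  have hae : ∀ᵐ ω ∂P, Tendsto
      (fun n => zeroMeasure (rootPoly (perturbedZeros z σ (fun i => ξ i ω)) n)) atTop
      (𝓝 μ.toFiniteMeasure) := by
    filter_upwards [tendsto_cesaro_norm_perturbation hξ_indep hξ_ident hξ_int hσ_pos hσ_lim]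
      with ω hω
    have hd : IsDistributed μ (perturbedZeros z σ (fun i => ξ i ω)) := by
      refine hz.of_tendsto_cesaro (hω.congr fun n => ?_)
      congr 1
      refine Finset.sum_congr rfl fun i _ => ?_
      simp [perturbedZeros, abs_of_pos (hσ_pos i)]
    exact hd.congr fun n => (zeroMeasure_prod_X_sub_C _ n).symm
  refine ⟨hae, fun k => ?_⟩
  rw [tendstoInProbability_iff]
  refine tendsto_toFiniteMeasure_of_compactSupport ?_ fun f hf hfc => ?_
  -- For `n ≤ k` the derivative has no zeros and its zero measure is null, so the mass is `1` only
  -- from `n > k` on.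
  · filter_upwards [(tendsto_fst_probFilter P).eventually_gt_atTop k] with x hx
    refine mass_zeroMeasure ?_
    rw [card_roots_iterate_derivative_rootPoly _ hx.le]
    exact Nat.sub_pos_of_lt hx
  · have h1 := h.tendsto_integral_zeroMeasure_sub hξ_int hz_log hσ_pos hσ_lim k hf hfc
    have h2 : Tendsto (fun x : ℕ × Ω => ∫ a, f a ∂(zeroMeasure
        (rootPoly (perturbedZeros z σ (fun i => ξ i x.2)) x.1) : Measure ℂ))
        (probFilter P) (𝓝 (∫ a, f a ∂(μ : Measure ℂ))) := by
      refine tendsto_probFilter_of_ae (Y := fun n ω => ∫ a, f a ∂(zeroMeasure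
        (rootPoly (perturbedZeros z σ (fun i => ξ i ω)) n) : Measure ℂ)) (fun n => ?_) ?_
      · simp_rw [rootPoly, zeroMeasure_prod_X_sub_C, integral_seqEmpiricalMeasure]
        exact (Finset.measurable_sum _ fun i _ => hf.measurable.comp
          (measurable_perturbedZeros hξ_meas z σ i)).const_mul _
      · filter_upwards [hae] with ω hω
        have := (FiniteMeasure.tendsto_iff_forall_integral_tendsto.1 hω)
          (BoundedContinuousFunction.ofNormedAddCommGroup f hf _
            (hfc.exists_bound_of_continuous hf).choose_spec)
        simp only [BoundedContinuousFunction.coe_ofNormedAddCommGroup] at this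
        exact this
    have h3 := h1.add h2
    rw [zero_add] at h3
    exact h3.congr fun x => by ring
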